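/- For a group $K$ and $g\in K$ write $C_K(g)$ for the centralizer of $g$. Let $K$ be a non-cyclic torsion-free hyperbolic group (so that $C_K(g)$ is cyclic for every $g\neq 1$). The \emph{basic sorts} of $K$ are the home sort $K$ itself and the sets of classes of the following equivalence relations, for all $m,n\in\mathbb N=\{0,1,2,\dots\}$: * conjugation on $K$; * the $m$-left-coset relation on $K^2$: $(a_1,b_1)\sim(a_2,b_2)$ iff either $b_1=b_2=1$, or $b_1,b_2\ne 1$, $C_K(b_1)=C_K(b_2)=\langle b\rangle$ and $a_1^{-1}a_2\in\langle b^m\rangle$; * the $m$-right-coset relation on $K^2$: the same with $a_1a_2^{-1}\in\langle b^m\rangle$; * the $m,n$-double-coset relation on $K^3$: $(a_1,b_1,c_1)\sim(a_2,b_2,c_2)$ iff either ($a_1=1$ or $c_1=1$) and ($a_2=1$ or $c_2=1$), or $a_1,c_1,a_2,c_2\neq 1$, $C_K(a_1)=C_K(a_2)=\langle a\rangle$, $C_K(c_1)=C_K(c_2)=\langle c\rangle$ and $\gamma b_1\varepsilon=b_2$ for some $\gamma\in\langle a^m\rangle$, $\varepsilon\in\langle c^n\rangle$. Let $K^{we}$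 be the disjoint union of all basic sorts of $K$; $\mathrm{Aut}(K)$ acts on it. An element of $K^{we}$ is called trivial if it is the class of a tuple all of whose entries are $1$. Let $G$ be a torsion-free hyperbolic group and $H=G*\langle e\rangle$ with $e$ of infinite order. Let $G^{we}\subseteq H^{we}$ be the set of the elements that are represented by tuples from $G$. For $a\in G$ let $f_a$ be the automorphism of $H$ that is the identity on $G$ and sends $e$ to $ea$. (1) Let $a,c\in G\setminus\{1\}$ with $C_G(a)\neq C_G(c)$. Then every $\beta\in H^{we}\setminus G^{we}$ has infinite orbit under the subgroup of $\mathrm{Aut}(H)$ generated by $f_a$ and $f_c$. (2) In particular, let $G=A*B$ be a free product of non-trivial subgroups $A,B$. Then $\mathrm{Aut}(H).\beta$ is infinite for every $\beta\in H^{we}\setminus G^{we}$. Moreover, $\mathrm{Aut}(H).\beta$ is infinite for every non-trivial $\beta\in H^{we}$ that is not the conjugacy class in $H$ of an element of $A\cup B$. -/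

import Mathlib

/-- A group is (word-)hyperbolic if it has a finite generating set whose Cayley graph, with the
word metric on its vertices, satisfies Gromov's four-point condition for some constant. -/
def IsHyperbolicGroup (G : Type*) [Group G] : Prop :=
  ∃ S : Finset G, Subgroup.closure (S : Set G) = ⊤ ∧
    ∃ δ : ℕ, ∀ x y z w : G,
      (SimpleGraph.mulCayley (S : Set G)).dist x y + (SimpleGraph.mulCayley (S : Set G)).dist z w ≤
        max
          ((SimpleGraph.mulCayley (S : Set G)).dist x z +
            (SimpleGraph.mulCayley (S : Set G)).dist y w)
          ((SimpleGraph.mulCayley (S : Set G)).dist x w +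
            (SimpleGraph.mulCayley (S : Set G)).dist y z) + δ

/-- No element other than `1` has finite order. -/
def IsTorsionFreeGroup (G : Type*) [Group G] : Prop :=
  ∀ g : G, g ≠ 1 → ¬ IsOfFinOrder g

/-- The centralizer of an element. -/
abbrev elemCentralizer {G : Type*} [Group G] (g : G) : Subgroup G :=
  Subgroup.centralizer {g}

/-- The `m`-left-coset relation on pairs `(a, b)`. The pairs with `b = 1` form one class. -/
def LeftCosetRel (G : Type*) [Group G] (m : ℕ) (x y : G × G) : Prop :=
  (x.2 = 1 ∧ y.2 = 1) ∨
  (x.2 ≠ 1 ∧ y.2 ≠ 1 ∧ ∃ b : G,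
    elemCentralizer x.2 = Subgroup.zpowers b ∧ elemCentralizer y.2 = Subgroup.zpowers b ∧
    x.1⁻¹ * y.1 ∈ Subgroup.zpowers (b ^ m))

/-- The `m`-right-coset relation on pairs `(a, b)`. The pairs with `b = 1` form one class. -/
def RightCosetRel (G : Type*) [Group G] (m : ℕ) (x y : G × G) : Prop :=
  (x.2 = 1 ∧ y.2 = 1) ∨
  (x.2 ≠ 1 ∧ y.2 ≠ 1 ∧ ∃ b : G,
    elemCentralizer x.2 = Subgroup.zpowers b ∧ elemCentralizer y.2 = Subgroup.zpowers b ∧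
    x.1 * y.1⁻¹ ∈ Subgroup.zpowers (b ^ m))

/-- The `m,n`-double-coset relation on triples `(a, b, c)`. The triples with `a = 1` or `c = 1`
form one class. -/
def DoubleCosetRel (G : Type*) [Group G] (m n : ℕ) (x y : G × G × G) : Prop :=
  ((x.1 = 1 ∨ x.2.2 = 1) ∧ (y.1 = 1 ∨ y.2.2 = 1)) ∨
  (x.1 ≠ 1 ∧ x.2.2 ≠ 1 ∧ y.1 ≠ 1 ∧ y.2.2 ≠ 1 ∧ ∃ a c : G,
    elemCentralizer x.1 = Subgroup.zpowers a ∧ elemCentralizer y.1 = Subgroup.zpowers a ∧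
    elemCentralizer x.2.2 = Subgroup.zpowers c ∧ elemCentralizer y.2.2 = Subgroup.zpowers c ∧
    ∃ γ ∈ Subgroup.zpowers (a ^ m), ∃ ε ∈ Subgroup.zpowers (c ^ n), γ * x.2.1 * ε = y.2.1)

theorem zpowers_pow_eq {G : Type*} [Group G] {b b' : G} (m : ℕ)
    (h : Subgroup.zpowers b = Subgroup.zpowers b') :
    Subgroup.zpowers (b ^ m) = Subgroup.zpowers (b' ^ m) := by
  have key : ∀ u v : G, Subgroup.zpowers u = Subgroup.zpowers v →
      Subgroup.zpowers (u ^ m) ≤ Subgroup.zpowers (v ^ m) := by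
    intro u v huv
    have hu : u ∈ Subgroup.zpowers v := huv ▸ Subgroup.mem_zpowers u
    obtain ⟨k, rfl⟩ := Subgroup.mem_zpowers_iff.1 hu
    rw [Subgroup.zpowers_le]
    refine Subgroup.mem_zpowers_iff.2 ⟨k, ?_⟩
    rw [← zpow_natCast, ← zpow_natCast, ← zpow_mul, ← zpow_mul, mul_comm]
  exact le_antisymm (key _ _ h) (key _ _ h.symm)

/-- All centralizers of nontrivial elements are cyclic; this holds in torsion-free hyperbolic
groups and is what makes the coset relations reflexive. -/
def HasCyclicCentralizers (G : Type*) [Group G] : Prop :=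
  ∀ g : G, g ≠ 1 → ∃ b : G, elemCentralizer g = Subgroup.zpowers b

theorem leftCosetRel_equivalence {G : Type*} [Group G] (hG : HasCyclicCentralizers G) (m : ℕ) :
    Equivalence (LeftCosetRel G m) where
  refl x := by
    by_cases h : x.2 = 1
    · exact Or.inl ⟨h, h⟩
    · obtain ⟨b, hb⟩ := hG x.2 h
      exact Or.inr ⟨h, h, b, hb, hb, by simp⟩
  symm := by
    rintro x y (⟨h1, h2⟩ | ⟨h1, h2, b, h3, h4, h5⟩)
    · exact Or.inl ⟨h2, h1⟩
    · refine Or.inr ⟨h2, h1, b, h4, h3, ?_⟩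
      simpa using inv_mem h5
  trans := by
    rintro x y z (⟨h1, h2⟩ | ⟨h1, h2, b, h3, h4, h5⟩) (⟨k1, k2⟩ | ⟨k1, k2, b', k3, k4, k5⟩)
    · exact Or.inl ⟨h1, k2⟩
    · exact absurd h2 k1
    · exact absurd k1 h2
    · refine Or.inr ⟨h1, k2, b', h3.trans (h4.symm.trans k3), k4, ?_⟩
      rw [zpowers_pow_eq m (h4.symm.trans k3)] at h5
      simpa [mul_assoc] using mul_mem h5 k5

theorem rightCosetRel_equivalence {G : Type*} [Group G] (hG : HasCyclicCentralizers G) (m : ℕ) :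
    Equivalence (RightCosetRel G m) where
  refl x := by
    by_cases h : x.2 = 1
    · exact Or.inl ⟨h, h⟩
    · obtain ⟨b, hb⟩ := hG x.2 h
      exact Or.inr ⟨h, h, b, hb, hb, by simp⟩
  symm := by
    rintro x y (⟨h1, h2⟩ | ⟨h1, h2, b, h3, h4, h5⟩)
    · exact Or.inl ⟨h2, h1⟩
    · refine Or.inr ⟨h2, h1, b, h4, h3, ?_⟩
      simpa using inv_mem h5
  trans := by
    rintro x y z (⟨h1, h2⟩ | ⟨h1, h2, b, h3, h4, h5⟩) (⟨k1, k2⟩ | ⟨k1, k2, b', k3, k4, k5⟩)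
    · exact Or.inl ⟨h1, k2⟩
    · exact absurd h2 k1
    · exact absurd k1 h2
    · refine Or.inr ⟨h1, k2, b', h3.trans (h4.symm.trans k3), k4, ?_⟩
      rw [zpowers_pow_eq m (h4.symm.trans k3)] at h5
      simpa [mul_assoc] using mul_mem h5 k5

theorem doubleCosetRel_equivalence {G : Type*} [Group G] (hG : HasCyclicCentralizers G)
    (m n : ℕ) : Equivalence (DoubleCosetRel G m n) where
  refl x := by
    by_cases h : x.1 = 1 ∨ x.2.2 = 1
    · exact Or.inl ⟨h, h⟩
    · rw [not_or] at h
      obtain ⟨a, ha⟩ := hG x.1 h.1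
      obtain ⟨c, hc⟩ := hG x.2.2 h.2
      exact Or.inr ⟨h.1, h.2, h.1, h.2, a, c, ha, ha, hc, hc, 1, one_mem _, 1, one_mem _, by simp⟩
  symm := by
    rintro x y (⟨h1, h2⟩ | ⟨h1, h2, h3, h4, a, c, h5, h6, h7, h8, γ, hγ, ε, hε, h9⟩)
    · exact Or.inl ⟨h2, h1⟩
    · refine Or.inr ⟨h3, h4, h1, h2, a, c, h6, h5, h8, h7, γ⁻¹, inv_mem hγ, ε⁻¹, inv_mem hε, ?_⟩
      rw [← h9]
      group
  trans := by
    rintro x y z (⟨h1, h2⟩ | ⟨h1, h2, h3, h4, a, c, h5, h6, h7, h8, γ, hγ, ε, hε, h9⟩)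
      (⟨k1, k2⟩ | ⟨k1, k2, k3, k4, a', c', k5, k6, k7, k8, γ', kγ, ε', kε, k9⟩)
    · exact Or.inl ⟨h1, k2⟩
    · exact absurd h2 (not_or.2 ⟨k1, k2⟩)
    · exact absurd k1 (not_or.2 ⟨h3, h4⟩)
    · rw [zpowers_pow_eq m (h6.symm.trans k5)] at hγ
      rw [zpowers_pow_eq n (h8.symm.trans k7)] at hε
      refine Or.inr ⟨h1, h2, k3, k4, a', c', h5.trans (h6.symm.trans k5), k6,
        h7.trans (h8.symm.trans k7), k8, γ' * γ, mul_mem kγ hγ, ε * ε', mul_mem hε kε, ?_⟩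
      rw [← k9, ← h9]
      group

theorem elemCentralizer_map {G : Type*} [Group G] (f : MulAut G) {g b : G}
    (h : elemCentralizer g = Subgroup.zpowers b) :
    elemCentralizer (f g) = Subgroup.zpowers (f b) := by
  ext z
  have h1 : f.symm z ∈ elemCentralizer g ↔ f.symm z ∈ Subgroup.zpowers b := by rw [h]
  rw [Subgroup.mem_centralizer_singleton_iff, Subgroup.mem_zpowers_iff] at h1
  rw [Subgroup.mem_centralizer_singleton_iff, Subgroup.mem_zpowers_iff]
  rw [← f.injective.eq_iff] at h1
  simp only [map_mul, MulEquiv.apply_symm_apply] at h1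
  rw [h1]
  simp only [MulEquiv.eq_symm_apply, map_zpow]

theorem map_mem_zpowers_pow {G : Type*} [Group G] (f : MulAut G) {z b : G} {m : ℕ}
    (h : z ∈ Subgroup.zpowers (b ^ m)) : f z ∈ Subgroup.zpowers (f b ^ m) := by
  obtain ⟨k, rfl⟩ := Subgroup.mem_zpowers_iff.1 h
  exact Subgroup.mem_zpowers_iff.2 ⟨k, by simp only [map_zpow, map_pow]⟩

theorem LeftCosetRel.map {G : Type*} [Group G] (f : MulAut G) (m : ℕ) (x y : G × G)
    (h : LeftCosetRel G m x y) : LeftCosetRel G m (f x.1, f x.2) (f y.1, f y.2) := by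
  rcases h with ⟨h1, h2⟩ | ⟨h1, h2, b, h3, h4, h5⟩
  · exact Or.inl ⟨by simp [h1], by simp [h2]⟩
  · refine Or.inr ⟨by simpa using h1, by simpa using h2, f b, elemCentralizer_map f h3,
      elemCentralizer_map f h4, ?_⟩
    simpa only [map_mul, map_inv] using map_mem_zpowers_pow f h5

theorem RightCosetRel.map {G : Type*} [Group G] (f : MulAut G) (m : ℕ) (x y : G × G)
    (h : RightCosetRel G m x y) : RightCosetRel G m (f x.1, f x.2) (f y.1, f y.2) := by
  rcases h with ⟨h1, h2⟩ | ⟨h1, h2, b, h3, h4, h5⟩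
  · exact Or.inl ⟨by simp [h1], by simp [h2]⟩
  · refine Or.inr ⟨by simpa using h1, by simpa using h2, f b, elemCentralizer_map f h3,
      elemCentralizer_map f h4, ?_⟩
    simpa only [map_mul, map_inv] using map_mem_zpowers_pow f h5

theorem DoubleCosetRel.map {G : Type*} [Group G] (f : MulAut G) (m n : ℕ) (x y : G × G × G)
    (h : DoubleCosetRel G m n x y) :
    DoubleCosetRel G m n (f x.1, f x.2.1, f x.2.2) (f y.1, f y.2.1, f y.2.2) := by
  rcases h with ⟨h1, h2⟩ | ⟨h1, h2, h3, h4, a, c, h5, h6, h7, h8, γ, hγ, ε, hε, h9⟩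
  · exact Or.inl ⟨by simpa using h1, by simpa using h2⟩
  · refine Or.inr ⟨by simpa using h1, by simpa using h2, by simpa using h3, by simpa using h4,
      f a, f c, elemCentralizer_map f h5, elemCentralizer_map f h6, elemCentralizer_map f h7,
      elemCentralizer_map f h8, f γ, map_mem_zpowers_pow f hγ, f ε,
      map_mem_zpowers_pow f hε, ?_⟩
    simp only [← h9, map_mul]

/-- The elements of the expansion `G^we` of `G` by the basic sorts: elements of the home sort `G`,
conjugacy classes, and classes of the `m`-left-coset, `m`-right-coset and `m,n`-double-coset
relations, for all `m` and `n`. -/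
inductive WE (G : Type*) [Group G]
  | home (g : G) : WE G
  | conj (β : ConjClasses G) : WE G
  | leftCoset (m : ℕ) (β : Quot (LeftCosetRel G m)) : WE G
  | rightCoset (m : ℕ) (β : Quot (RightCosetRel G m)) : WE G
  | doubleCoset (m n : ℕ) (β : Quot (DoubleCosetRel G m n)) : WE G

namespace WE

/-- The canonical action of an automorphism of `G` on `G^we`. -/
def map {G : Type*} [Group G] (f : MulAut G) : WE G → WE G
  | home g => home (f g)
  | conj β => conj (ConjClasses.map (f : G →* G) β)
  | leftCoset m β =>
      leftCoset m (Quot.map (fun x => (f x.1, f x.2)) (LeftCosetRel.map f m) β)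
  | rightCoset m β =>
      rightCoset m (Quot.map (fun x => (f x.1, f x.2)) (RightCosetRel.map f m) β)
  | doubleCoset m n β =>
      doubleCoset m n
        (Quot.map (fun x => (f x.1, f x.2.1, f x.2.2)) (DoubleCosetRel.map f m n) β)

/-- The canonical action of `Aut(G)` on `G^we`. -/
instance {G : Type*} [Group G] : MulAction (MulAut G) (WE G) where
  smul f β := map f β
  one_smul := by
    rintro (g | ⟨⟨g⟩⟩ | ⟨m, ⟨x⟩⟩ | ⟨m, ⟨x⟩⟩ | ⟨m, n, ⟨x⟩⟩) <;> rfl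
  mul_smul := by
    rintro f g (h | ⟨⟨h⟩⟩ | ⟨m, ⟨x⟩⟩ | ⟨m, ⟨x⟩⟩ | ⟨m, n, ⟨x⟩⟩) <;> rfl

/-- For an embedding `i : G → H`, the predicate on `H^we` of lying in `G^we`, i.e. of being the
class of a tuple of elements of `G`. -/
inductive ComesFrom {G H : Type*} [Group G] [Group H] (i : G →* H) : WE H → Prop
  | home (a : G) : ComesFrom i (home (i a))
  | conj (a : G) : ComesFrom i (conj (ConjClasses.mk (i a)))
  | leftCoset (m : ℕ) (a b : G) : ComesFrom i (leftCoset m (Quot.mk _ (i a, i b)))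
  | rightCoset (m : ℕ) (a b : G) : ComesFrom i (rightCoset m (Quot.mk _ (i a, i b)))
  | doubleCoset (m n : ℕ) (a b c : G) :
      ComesFrom i (doubleCoset m n (Quot.mk _ (i a, i b, i c)))

/-- The trivial element of a sort is the class of the tuple all of whose entries are `1`. -/
inductive IsTrivial {G : Type*} [Group G] : WE G → Prop
  | home : IsTrivial (home 1)
  | conj : IsTrivial (conj (ConjClasses.mk 1))
  | leftCoset (m : ℕ) : IsTrivial (leftCoset m (Quot.mk _ (1, 1)))
  | rightCoset (m : ℕ) : IsTrivial (rightCoset m (Quot.mk _ (1, 1)))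
  | doubleCoset (m n : ℕ) : IsTrivial (doubleCoset m n (Quot.mk _ (1, 1, 1)))

end WE

/-- The free product `G * ⟨e⟩` of `G` with an infinite cyclic group. -/
abbrev AdjoinFree (G : Type*) [Group G] : Type _ :=
  Monoid.Coprod G (Multiplicative ℤ)

namespace AdjoinFree

/-- The embedding of `G` in `G * ⟨e⟩`. -/
def ofBase {G : Type*} [Group G] : G →* AdjoinFree G := Monoid.Coprod.inl

/-- The free generator `e`. -/
def e {G : Type*} [Group G] : AdjoinFree G := Monoid.Coprod.inr (Multiplicative.ofAdd 1)

/-- The endomorphism of `G * ⟨e⟩` that is the identity on `G` and sends `e` to `e a`. -/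
def shiftHom {G : Type*} [Group G] (a : G) : AdjoinFree G →* AdjoinFree G :=
  Monoid.Coprod.lift ofBase (zpowersHom (AdjoinFree G) (e * ofBase a))

theorem shiftHom_ofBase {G : Type*} [Group G] (a g : G) :
    shiftHom a (ofBase g) = ofBase g := rfl

theorem shiftHom_e {G : Type*} [Group G] (a : G) :
    shiftHom a e = e * ofBase a := by
  simp [shiftHom, e]

theorem shiftHom_comp {G : Type*} [Group G] {a b : G} (h : a * b = 1) :
    (shiftHom a).comp (shiftHom b) = MonoidHom.id (AdjoinFree G) := by
  refine Monoid.Coprod.hom_ext rfl (MonoidHom.ext_mint ?_)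
  change shiftHom a (shiftHom b e) = e
  rw [shiftHom_e, map_mul, shiftHom_e, shiftHom_ofBase, mul_assoc, ← map_mul, h, map_one, mul_one]

/-- The automorphism `f_a` of `G * ⟨e⟩` that is the identity on `G` and sends `e` to `e a`. -/
def shift {G : Type*} [Group G] (a : G) : MulAut (AdjoinFree G) :=
  MonoidHom.toMulEquiv (shiftHom a) (shiftHom a⁻¹) (shiftHom_comp (inv_mul_cancel a))
    (shiftHom_comp (mul_inv_cancel a))

theorem shift_ofBase {G : Type*} [Group G] (a g : G) :
    shift a (ofBase g) = ofBase g := rfl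

theorem shift_e {G : Type*} [Group G] (a : G) :
    shift a e = e * ofBase a := shiftHom_e a

end AdjoinFree

/-- `G` is the (internal) free product of its nontrivial subgroups `A` and `B`. -/
def IsNontrivialFreeProduct {G : Type*} [Group G] (A B : Subgroup G) : Prop :=
  A ≠ ⊥ ∧ B ≠ ⊥ ∧ Function.Bijective (Monoid.Coprod.lift A.subtype B.subtype)

/-! Every element of $H=G*\langle e\rangle$ is uniquely $g\,e^{\varepsilon_1}g_1\cdots
e^{\varepsilon_k}g_k$ with $\varepsilon_i=\pm1$ and no cancellation. The map $f_s$ puts $s$ behind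
each $e$ and $s^{-1}$ in front of each $e^{-1}$. A coefficient $x$ between signs $(+,+)$, $(+,-)$,
$(-,+)$, $(-,-)$ thus becomes $sx$, $sxs^{-1}$, $x$, $xs^{-1}$, and the word stays reduced. If a
word with letters is fixed by $f_a$ and $f_c$, its first sign is $+$, the next is $-$, and the
coefficient between them commutes with $a$ and $c$. When $a$ and $c$ are independent
(`IsIndependent`) that coefficient is $1$, which contradicts reducedness.

This argument is adapted to each sort. `mem_range_of_shift_eq_mul` allows multiplication by base
elements on both sides, as needed for cosets. `exists_isConj_ofBase` treats conjugacy classes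
through cyclically reduced words, which are determined up to rotation. For coset classes, a
generator of a cyclic centralizer is moved only among finitely many generators, so powers of the
shifts fix it and it lies in $G$. If a centralizer in the class is not cyclic, the class is a single
tuple.

If the orbit of $\beta$ is finite, some $f_{a^k}$ and $f_{c^l}$ with $k,l>0$ fix $\beta$, and
`comesFrom_of_smul_eq` puts $\beta$ in $G^{we}$. Hyperbolicity enters only through commutative
transitivity (`IsHyperbolicGroup.commute_of_commute`): it keeps powers of $a,c$ independent and
derives independence from distinct centralizers.

For $G=A*B$, nontrivial elements of the two factors are independent. An element of $G^{we}$ is moved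
out of $G^{we}$ by conjugation by $e$ or, for conjugacy classes, by the automorphism that conjugates
only $B$ by $e$; its orbit is then infinite by the previous case. -/

/-! ### Word metrics on Cayley graphs -/

namespace SimpleGraph

theorem Connected.exists_dist_eq_of_dist_eq_add {V : Type*} {Γ : SimpleGraph V}
    (hΓ : Γ.Connected) {u v : V} {j k : ℕ} (h : Γ.dist u v = j + k) :
    ∃ w, Γ.dist u w = j ∧ Γ.dist w v = k := by
  obtain ⟨p, hp⟩ := hΓ.exists_walk_length_eq_dist u v
  have h1 := Γ.dist_le (p.take j)
  have h2 := Γ.dist_le (p.drop j)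
  have h3 := hΓ.dist_triangle (u := u) (v := p.getVert j) (w := v)
  rw [Walk.take_length] at h1
  rw [Walk.drop_length] at h2
  exact ⟨p.getVert j, by omega, by omega⟩

variable {G : Type*} [Group G] {S : Set G}

theorem mulCayley_connected (hS : Subgroup.closure S = ⊤) : (mulCayley S).Connected := by
  have key : ∀ g : G, ∀ u : G, (mulCayley S).Reachable u (u * g) := by
    intro g
    have hg : g ∈ Subgroup.closure S := hS ▸ Subgroup.mem_top g
    induction hg using Subgroup.closure_induction with
    | mem s hs =>
      intro u
      by_cases h : u = u * s
      · rw [← h]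
      · exact Adj.reachable ((mulCayley_adj S _ _).2 ⟨h, Or.inl (by simpa using hs)⟩)
    | one => intro u; simp
    | mul x y _ _ hx hy => intro u; rw [← mul_assoc]; exact (hx u).trans (hy _)
    | inv x _ hx => intro u; simpa using (hx (u * x⁻¹)).symm
  have : Nonempty G := ⟨1⟩
  exact ⟨fun u v => by simpa using key (u⁻¹ * v) u⟩

theorem mulCayley_dist_mul_left_le (hS : Subgroup.closure S = ⊤) (g u v : G) :
    (mulCayley S).dist (g * u) (g * v) ≤ (mulCayley S).dist u v := by
  obtain ⟨p, hp⟩ := (mulCayley_connected hS).exists_walk_length_eq_dist u v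
  let f : mulCayley S →g mulCayley S :=
    ⟨fun x => g * x, fun {a b} h => mulCayley_adj_mul_iff_right.2 h⟩
  have := (mulCayley S).dist_le (p.map f)
  rw [Walk.length_map, hp] at this
  exact this

theorem mulCayley_dist_mul_left (hS : Subgroup.closure S = ⊤) (g u v : G) :
    (mulCayley S).dist (g * u) (g * v) = (mulCayley S).dist u v := by
  refine le_antisymm (mulCayley_dist_mul_left_le hS g u v) ?_
  simpa using mulCayley_dist_mul_left_le hS g⁻¹ (g * u) (g * v)

theorem mulCayley_ball_finite (hS : Subgroup.closure S = ⊤) (hfin : S.Finite) (n : ℕ) :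
    {x : G | (mulCayley S).dist 1 x ≤ n}.Finite := by
  have hc := mulCayley_connected hS
  induction n with
  | zero =>
    refine (Set.finite_singleton (1 : G)).subset fun x hx => ?_
    exact (hc.dist_eq_zero_iff.1 (Nat.le_zero.1 hx)).symm
  | succ n ih =>
    refine (ih.union (Set.Finite.image2 (fun x y => x * y) ih
      (hfin.union hfin.inv))).subset fun x hx => ?_
    by_cases h : (mulCayley S).dist 1 x ≤ n
    · exact Or.inl h
    · obtain ⟨w, hw, hw'⟩ := hc.exists_dist_eq_of_dist_eq_add
        (u := 1) (v := x) (j := n) (k := 1) (by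
          have : (mulCayley S).dist 1 x ≤ n + 1 := hx
          omega)
      rw [dist_eq_one_iff_adj, mulCayley_adj] at hw'
      refine Or.inr ⟨w, hw.le, w⁻¹ * x, ?_, by simp⟩
      rcases hw'.2 with h | h
      · exact Or.inl h
      · exact Or.inr (by simpa using h)

end SimpleGraph

/-! ### Centralizers in torsion-free hyperbolic groups -/

/-- A positive power that moves every member of a finite family of torsion-free elements out of
a given finite set. -/
theorem exists_pos_pow_notMem {G : Type*} [Group G] (htf : IsTorsionFreeGroup G)
    {F B : Set G} (hF : F.Finite) (hB : B.Finite) :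
    ∃ N : ℕ, 0 < N ∧ ∀ f ∈ F, f ≠ 1 → f ^ N ∉ B := by
  have hbad : (⋃ f ∈ F, {N : ℕ | f ≠ 1 ∧ f ^ N ∈ B}).Finite := by
    refine hF.biUnion fun f _ => ?_
    by_cases h : f = 1
    · simp [h]
    · refine (Set.Finite.preimage (f := fun N : ℕ => f ^ N) ?_ hB).subset fun N hN => hN.2
      exact (injective_pow_iff_not_isOfFinOrder.2 (htf f h)).injOn
  obtain ⟨N, hN⟩ := (hbad.union (Set.finite_singleton 0)).infinite_compl.nonempty
  simp only [Set.mem_compl_iff, Set.mem_union, Set.mem_iUnion, Set.mem_ofPred_eq,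
    Set.mem_singleton_iff, not_or, not_exists] at hN
  exact ⟨N, Nat.pos_of_ne_zero hN.2, fun f hf hf1 hfN => hN.1 f hf ⟨hf1, hfN⟩⟩

/-- In a torsion-free hyperbolic group, finitely many cosets of a cyclic subgroup `⟨g ^ N⟩` cover
the centralizer of `g`. -/
theorem IsHyperbolicGroup.exists_finite_coset_representatives {G : Type*} [Group G]
    (hG : IsHyperbolicGroup G) (htf : IsTorsionFreeGroup G) {g : G} (hg : g ≠ 1) :
    ∃ B : Set G, B.Finite ∧ ∀ x : G, Commute g x → ∃ z : ℤ, g ^ z * x ∈ B := by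
  obtain ⟨S, hS, δ, hδ⟩ := hG
  set d := (SimpleGraph.mulCayley (S : Set G)).dist with hd
  have hc := SimpleGraph.mulCayley_connected hS
  have hinv : ∀ g u v, d (g * u) (g * v) = d u v := SimpleGraph.mulCayley_dist_mul_left hS
  have htri : ∀ u v w, d u w ≤ d u v + d v w := fun u v w => hc.dist_triangle
  have hsymm : ∀ u v, d u v = d v u := fun u v => SimpleGraph.dist_comm
  have hfin : ∀ n : ℕ, {x : G | d 1 x ≤ n}.Finite :=
    SimpleGraph.mulCayley_ball_finite hS S.finite_toSet
  -- an element commuting with `h` displaces the geodesic to `h` by a bounded amount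
  have hdisp : ∀ k h p : G, Commute k h → d 1 p + d p h = d 1 h → d p (k * p) ≤ d 1 k + δ := by
    intro k h p hk hp
    have h1 := hδ 1 h p (k * p)
    have h2 : d h (k * p) ≤ d 1 k + d p h := by
      have h3 := htri h (k * h) (k * p)
      rw [hinv, hsymm h p] at h3
      have h4 := hinv h 1 k
      rw [mul_one, ← hk.eq] at h4
      omega
    have h5 : d 1 (k * p) ≤ d 1 k + d 1 p := by
      have h6 := htri 1 k (k * p)
      have h7 := hinv k 1 p
      rw [mul_one] at h7
      omega
    have h8 := hsymm h p
    change d 1 h + d p (k * p) ≤ max (d 1 p + d h (k * p)) (d 1 (k * p) + d h p) + δ at h1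
    omega
  -- The first ball contains every $p^{-1}gp$ with $p$ on a geodesic from $1$ to an element
  -- commuting with $g$, by `hdisp`. The second is the bound contradicted at the end.
  obtain ⟨N, hN0, hN⟩ := exists_pos_pow_notMem htf (hfin (d 1 g + δ)) (hfin (2 * δ))
  set k := g ^ N with hk
  -- With this size, the short sides of the quadrilateral $1,h,kh,k$ never attain the maximum in the
  -- four-point inequalities `q2` and `q3`.
  set M := 2 * d 1 k + 2 * δ + 1 with hM
  refine ⟨{x | d 1 x ≤ 2 * M}, hfin _, fun x hx => ?_⟩
  -- take a shortest element of the coset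
  obtain ⟨z, hz⟩ : ∃ z : ℤ, ∀ z' : ℤ, d 1 (g ^ z * x) ≤ d 1 (g ^ z' * x) := by
    exact ⟨Function.argmin (fun z : ℤ => d 1 (g ^ z * x)), fun z' =>
      Function.argmin_le (fun z : ℤ => d 1 (g ^ z * x)) z'⟩
  refine ⟨z, ?_⟩
  set h := g ^ z * x with hh
  by_contra hbig
  have hbig : 2 * M < d 1 h := not_le.1 hbig
  have hgh : Commute g h := ((Commute.refl g).zpow_right z).mul_right hx
  have hkh : Commute k h := hgh.pow_left N
  have hmin1 : d 1 h ≤ d 1 (k * h) := by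
    have := hz (N + z)
    rwa [zpow_add, zpow_natCast, mul_assoc] at this
  have hmin2 : d 1 h ≤ d k h := by
    have h1 := hz (-N + z)
    rw [zpow_add, zpow_neg, zpow_natCast, mul_assoc] at h1
    have h2 := hinv k 1 (k⁻¹ * h)
    rw [mul_one, mul_inv_cancel_left] at h2
    change d 1 h ≤ d 1 (k⁻¹ * h) at h1
    omega
  obtain ⟨p, hp1, hp2⟩ := hc.exists_dist_eq_of_dist_eq_add
    (u := 1) (v := h) (j := M) (k := d 1 h - M) (by change d 1 h = _; omega)
  change d 1 p = M at hp1
  change d p h = d 1 h - M at hp2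
  have hpg := hdisp g h p hgh (by omega)
  have hpk := hdisp k h p hkh (by omega)
  -- Here $d(p,kp)$ is the length of $p^{-1}kp=(p^{-1}gp)^N$, and $N$ keeps this power out of the
  -- ball of radius $2\delta$.
  have hD : 2 * δ < d p (k * p) := by
    have h1 := hN (p⁻¹ * (g * p)) (by
      have := hinv p 1 (p⁻¹ * (g * p))
      rw [mul_one, mul_inv_cancel_left] at this
      change d 1 _ ≤ _
      omega) (by
      intro h0
      refine hg ?_
      have := congrArg (fun y => p * y * p⁻¹) h0
      simpa [mul_assoc] using this)
    have h2 : (p⁻¹ * (g * p)) ^ N = p⁻¹ * (k * p) := by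
      have := conj_pow (a := p⁻¹) (b := g) (i := N)
      simpa [mul_assoc] using this
    rw [h2] at h1
    have h3 := hinv p 1 (p⁻¹ * (k * p))
    rw [mul_one, mul_inv_cancel_left] at h3
    have h4 : ¬ d 1 (p⁻¹ * (k * p)) ≤ 2 * δ := h1
    omega
  have hkp : d k (k * p) = d 1 p := by simpa using hinv k 1 p
  have hkhp : d (k * p) (k * h) = d p h := hinv k p h
  have hhk : d h (k * h) = d 1 k := by
    rw [hkh.eq]; simpa using hinv h 1 k
  -- Minimality of $h$ gives $d(k,p)\ge d(1,p)$ and $d(p,kh)\ge d(p,h)$. So `q2` and `q3` yield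
  -- $d(1,kp)\le d(1,p)+\delta$ and $d(h,kp)\le d(p,h)+\delta$, and `q1` forces $d(p,kp)\le2\delta$,
  -- against `hD`.
  have q1 : d 1 h + d p (k * p) ≤ max (d 1 p + d h (k * p)) (d 1 (k * p) + d h p) + δ :=
    hδ 1 h p (k * p)
  have q2 : d 1 (k * p) + d k p ≤ max (d 1 k + d (k * p) p) (d 1 p + d (k * p) k) + δ :=
    hδ 1 (k * p) k p
  have q3 : d h (k * p) + d (k * h) p ≤
      max (d h (k * h) + d (k * p) p) (d h p + d (k * p) (k * h)) + δ :=
    hδ h (k * p) (k * h) p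
  have t1 := htri k p h
  have t2 := htri 1 p (k * h)
  have s1 := hsymm h p
  have s2 := hsymm p (k * p)
  have s3 := hsymm k (k * p)
  have s4 := hsymm p (k * h)
  omega

/-- Centralizers in torsion-free hyperbolic groups are commutative. -/
theorem IsHyperbolicGroup.commute_of_commute {G : Type*} [Group G]
    (hG : IsHyperbolicGroup G) (htf : IsTorsionFreeGroup G) {g x y : G} (hg : g ≠ 1)
    (hx : Commute g x) (hy : Commute g y) : Commute x y := by
  obtain ⟨B, hB, hB'⟩ := hG.exists_finite_coset_representatives htf hg
  let C := Subgroup.centralizer ({g} : Set G)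
  have hmem : ∀ {z}, z ∈ C ↔ Commute g z := by
    intro z
    rw [Subgroup.mem_centralizer_singleton_iff]
    exact ⟨fun h => h.symm, fun h => h.symm⟩
  have hgz : ∀ z : ℤ, (⟨g ^ z, hmem.2 ((Commute.refl g).zpow_right z)⟩ : C) ∈
      Subgroup.center C := by
    intro z
    rw [Subgroup.mem_center_iff]
    intro c
    exact Subtype.ext ((hmem.1 c.2).zpow_left z).eq.symm
  -- Powers of $g$ are central in its centralizer, so the finitely many coset representatives also
  -- cover the quotient by the center.
  have : Finite (C ⧸ Subgroup.center C) := by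
    have : Finite ((↑) ⁻¹' B : Set C) := (hB.preimage Subtype.val_injective.injOn).to_subtype
    refine Finite.of_surjective
      (fun b : ((↑) ⁻¹' B : Set C) => (QuotientGroup.mk b.1 : C ⧸ Subgroup.center C)) fun q => ?_
    obtain ⟨c, rfl⟩ := QuotientGroup.mk_surjective q
    obtain ⟨z, hz⟩ := hB' c (hmem.1 c.2)
    refine ⟨⟨⟨g ^ z, hmem.2 ((Commute.refl g).zpow_right z)⟩ * c, hz⟩, ?_⟩
    rw [QuotientGroup.eq]
    have h1 := Subgroup.mem_center_iff.1 (hgz z) c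
    simp only [← h1, mul_inv_rev, inv_mul_cancel_right]
    exact inv_mem (hgz z)
  have : (Subgroup.center C).FiniteIndex := Subgroup.finiteIndex_of_finite_quotient
  let x' : C := ⟨x, hmem.2 hx⟩
  let y' : C := ⟨y, hmem.2 hy⟩
  -- Schur's argument: the transfer $x\mapsto x^{[C:Z(C)]}$ is a homomorphism to an abelian group,
  -- so it kills commutators. These are then torsion, hence trivial.
  have h1 : MonoidHom.transferCenterPow C (x' * y' * x'⁻¹ * y'⁻¹) = 1 := by
    simp only [map_mul, map_inv]
    have hcomm : ∀ u v : Subgroup.center C, u * v = v * u := fun u v =>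
      Subtype.ext (Subgroup.mem_center_iff.1 v.2 u)
    rw [hcomm (MonoidHom.transferCenterPow C x')]
    simp
  have h2 : (x' * y' * x'⁻¹ * y'⁻¹) ^ (Subgroup.center C).index = 1 := by
    rw [← MonoidHom.transferCenterPow_apply, h1]; rfl
  have h3 : (x' * y' * x'⁻¹ * y'⁻¹ : C) = 1 := by
    by_contra h
    refine htf (x' * y' * x'⁻¹ * y'⁻¹ : C) (fun h0 => h (Subtype.ext h0)) ?_
    rw [isOfFinOrder_iff_pow_eq_one]
    exact ⟨_, Nat.pos_of_ne_zero Subgroup.FiniteIndex.index_ne_zero, congrArg Subtype.val h2⟩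
  rw [mul_inv_eq_one, mul_inv_eq_iff_eq_mul] at h3
  exact congrArg Subtype.val h3

/-! ### Normal forms in $G*\langle e\rangle$ -/

namespace AdjoinFree

variable {G : Type*} [Group G]

/-- The product `e ^ ε₁ * g₁ * ⋯ * e ^ εₖ * gₖ` of a list of pairs `(εᵢ, gᵢ)`. -/
def wordProd (l : List (ℤˣ × G)) : AdjoinFree G :=
  (l.map fun p => e ^ (p.1 : ℤ) * ofBase p.2).prod

@[simp] theorem wordProd_nil : wordProd ([] : List (ℤˣ × G)) = 1 := rfl

@[simp] theorem wordProd_cons (p : ℤˣ × G) (l : List (ℤˣ × G)) :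
    wordProd (p :: l) = e ^ (p.1 : ℤ) * ofBase p.2 * wordProd l := by
  simp [wordProd]

@[simp] theorem wordProd_append (l l' : List (ℤˣ × G)) :
    wordProd (l ++ l') = wordProd l * wordProd l' := by
  simp [wordProd]

/-- No cancellation takes place between the consecutive letters `p` and `q`. -/
def NoCancel (p q : ℤˣ × G) : Prop := p.2 = 1 → p.1 = q.1

/-- A list of letters without cancellation. -/
abbrev IsReduced (l : List (ℤˣ × G)) : Prop := l.IsChain NoCancel

/-- The trivial subgroups of `G`, with all of `G` as transversal. -/
def univTransversal (G : Type*) [Group G] :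
    HNNExtension.NormalWord.TransversalPair G (⊥ : Subgroup G) (⊥ : Subgroup G) where
  set _ := Set.univ
  compl u := by
    have : HNNExtension.toSubgroup (⊥ : Subgroup G) (⊥ : Subgroup G) u = ⊥ := by
      unfold HNNExtension.toSubgroup; split_ifs <;> rfl
    rw [this]
    exact Subgroup.isComplement_singleton_univ

/-- The comparison with the HNN extension of `G` along its trivial subgroup. -/
def toHNN (G : Type*) [Group G] : AdjoinFree G →*
    HNNExtension G (⊥ : Subgroup G) (⊥ : Subgroup G) (MulEquiv.refl _) :=
  Monoid.Coprod.lift HNNExtension.of (zpowersHom _ HNNExtension.t)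

/-- The inverse of `toHNN`. -/
def ofHNN (G : Type*) [Group G] :
    HNNExtension G (⊥ : Subgroup G) (⊥ : Subgroup G) (MulEquiv.refl _) →* AdjoinFree G :=
  HNNExtension.lift ofBase e (by
    rintro ⟨a, ha⟩
    obtain rfl := Subgroup.mem_bot.1 ha
    simp)

theorem toHNN_ofBase (g : G) : toHNN G (ofBase g) = HNNExtension.of g := rfl

theorem toHNN_e : toHNN G (e : AdjoinFree G) = HNNExtension.t := by
  simp [toHNN, AdjoinFree.e]

theorem ofHNN_of (g : G) : ofHNN G (HNNExtension.of g) = ofBase g :=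
  HNNExtension.lift_of _ _ _ g

theorem ofHNN_t : ofHNN G HNNExtension.t = e :=
  HNNExtension.lift_t _ _ _

theorem ofHNN_toHNN (x : AdjoinFree G) : ofHNN G (toHNN G x) = x := by
  have : (ofHNN G).comp (toHNN G) = MonoidHom.id _ := by
    refine Monoid.Coprod.hom_ext ?_ (MonoidHom.ext_mint ?_)
    · ext g
      exact ofHNN_of g
    · change ofHNN G (toHNN G e) = e
      rw [toHNN_e, ofHNN_t]
  exact DFunLike.congr_fun this x

theorem isReduced_iff {l : List (ℤˣ × G)} : IsReduced l ↔
    l.IsChain (fun a b => a.2 ∈ HNNExtension.toSubgroup (⊥ : Subgroup G) (⊥ : Subgroup G) a.1 →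
      a.1 = b.1) := by
  have : ∀ u, HNNExtension.toSubgroup (⊥ : Subgroup G) (⊥ : Subgroup G) u = ⊥ := by
    intro u
    unfold HNNExtension.toSubgroup; split_ifs <;> rfl
  simp only [this, Subgroup.mem_bot]
  rfl

theorem exists_reduced (x : AdjoinFree G) :
    ∃ (g : G) (l : List (ℤˣ × G)), IsReduced l ∧ x = ofBase g * wordProd l := by
  obtain ⟨w, hw⟩ := (HNNExtension.NormalWord.equiv (MulEquiv.refl (⊥ : Subgroup G))
    (univTransversal G)).symm.surjective (toHNN G x)
  refine ⟨w.head, w.toList, isReduced_iff.2 w.chain, ?_⟩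
  rw [← ofHNN_toHNN x, ← hw]
  change ofHNN G (w.toReducedWord.prod _) = _
  simp only [HNNExtension.NormalWord.ReducedWord.prod, map_mul, map_list_prod, List.map_map,
    wordProd, ofHNN_of, Function.comp_def, map_zpow, ofHNN_t]

/-- Over the trivial subgroup the transversal imposes no condition, so every reduced list is already
a normal word of the HNN extension, and normal forms there are unique. -/
theorem reduced_unique {g g' : G} {l l' : List (ℤˣ × G)} (hl : IsReduced l) (hl' : IsReduced l')
    (h : ofBase g * wordProd l = ofBase g' * wordProd l') : g = g' ∧ l = l' := by
  have key : ∀ (g : G) (l : List (ℤˣ × G)) (hl : IsReduced l),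
      toHNN G (ofBase g * wordProd l) = HNNExtension.NormalWord.ReducedWord.prod _
        (HNNExtension.NormalWord.toReducedWord (d := univTransversal G)
          ⟨⟨g, l, isReduced_iff.1 hl⟩, fun _ _ _ => Set.mem_univ _⟩) := by
    intro g l hl
    simp only [HNNExtension.NormalWord.ReducedWord.prod, map_mul, map_list_prod, List.map_map,
      wordProd]
    congr 1
    congr 1
    refine List.map_congr_left fun p _ => ?_
    simp only [Function.comp, map_mul, map_zpow, toHNN_ofBase, toHNN_e]
  have h1 := congrArg (toHNN G) h
  rw [key g l hl, key g' l' hl'] at h1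
  have h2 := HNNExtension.NormalWord.prod_injective _ _ h1
  exact ⟨congrArg (fun w => w.head) h2, congrArg (fun w => w.toList) h2⟩

/-- Cancellation depends only on the coefficient in front of a later letter, so the last coefficient
is free to absorb factors. -/
theorem isReduced_concat_iff {l : List (ℤˣ × G)} {ε : ℤˣ} {g : G} (g' : G) :
    IsReduced (l ++ [(ε, g)]) ↔ IsReduced (l ++ [(ε, g')]) := by
  simp [IsReduced, List.isChain_append, NoCancel]

theorem exists_mul_ofBase (g₀ g : G) {l : List (ℤˣ × G)} (hl : IsReduced l) :
    ∃ g₁ l₁, IsReduced l₁ ∧ l₁.length = l.length ∧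
      ofBase g₀ * wordProd l * ofBase g = ofBase g₁ * wordProd l₁ := by
  rcases List.eq_nil_or_concat l with rfl | ⟨l', ⟨ε, m⟩, rfl⟩
  · exact ⟨g₀ * g, [], hl, rfl, by simp⟩
  · rw [List.concat_eq_append] at *
    exact ⟨g₀, l' ++ [(ε, m * g)], (isReduced_concat_iff _).1 hl, by simp, by simp [mul_assoc]⟩

/-- The base is malnormal. -/
theorem mem_range_of_mul_eq_mul {z : AdjoinFree G} {w w' : G} (hw : w ≠ 1)
    (h : z * ofBase w = ofBase w' * z) : z ∈ (ofBase : G →* AdjoinFree G).range := by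
  obtain ⟨g, l, hl, rfl⟩ := exists_reduced z
  rcases List.eq_nil_or_concat l with rfl | ⟨l', ⟨ε, m⟩, rfl⟩
  · exact ⟨g, by simp⟩
  · rw [List.concat_eq_append] at *
    -- Right multiplication by $w$ changes only the last coefficient and left multiplication only
    -- the head, so uniqueness forces $mw=m$.
    have h1 : ofBase g * wordProd (l' ++ [(ε, m * w)]) =
        ofBase (w' * g) * wordProd (l' ++ [(ε, m)]) := by
      simpa [mul_assoc] using h
    have h2 := (reduced_unique ((isReduced_concat_iff _).1 hl) hl h1).2
    simp at h2
    exact absurd h2 hw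

theorem mem_range_of_conj_mem_range {z : AdjoinFree G} {w : G} (hw : w ≠ 1)
    (h : z * ofBase w * z⁻¹ ∈ (ofBase : G →* AdjoinFree G).range) :
    z ∈ (ofBase : G →* AdjoinFree G).range := by
  obtain ⟨w', hw'⟩ := h
  exact mem_range_of_mul_eq_mul hw (w' := w') (by rw [hw']; group)

theorem e_notMem_range : (e : AdjoinFree G) ∉ (ofBase : G →* AdjoinFree G).range := by
  rintro ⟨g, hg⟩
  have := (reduced_unique (g := g) (g' := 1) (l := []) (l' := [(1, 1)]) List.isChain_nil
    (List.isChain_singleton _) (by simpa using hg)).2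
  simp at this

/-! ### The automorphisms `shift` on words -/

theorem shift_pow (s : G) (n : ℕ) : shift s ^ n = shift (s ^ n) := by
  have hmul : ∀ a b : G, shift a * shift b = shift (a * b) := by
    intro a b
    ext x
    have : (shiftHom a).comp (shiftHom b) = shiftHom (a * b) := by
      refine Monoid.Coprod.hom_ext rfl (MonoidHom.ext_mint ?_)
      change shiftHom a (shiftHom b e) = shiftHom (a * b) e
      simp only [shiftHom_e, map_mul, shiftHom_ofBase, mul_assoc]
    exact DFunLike.congr_fun this x
  induction n with
  | zero =>
    ext x
    have : shiftHom (1 : G) = MonoidHom.id _ := by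
      refine Monoid.Coprod.hom_ext rfl (MonoidHom.ext_mint ?_)
      change shiftHom (1 : G) e = e
      simp [shiftHom_e]
    rw [pow_zero, pow_zero]
    exact (DFunLike.congr_fun this x).symm
  | succ n ih => rw [pow_succ, pow_succ, ih, hmul]

/-- The element that `shift s` puts in front of `e ^ ε`. -/
def leftTwist (s : G) (ε : ℤˣ) : G := if ε = 1 then 1 else s⁻¹

/-- The element that `shift s` puts behind `e ^ ε`. -/
def rightTwist (s : G) (ε : ℤˣ) : G := if ε = 1 then s else 1

theorem shift_e_zpow (s : G) (ε : ℤˣ) : shift s (e ^ (ε : ℤ)) =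
    ofBase (leftTwist s ε) * e ^ (ε : ℤ) * ofBase (rightTwist s ε) := by
  rcases Int.units_eq_one_or ε with rfl | rfl
  · simp [leftTwist, rightTwist, shift_e]
  · simp [leftTwist, rightTwist, shift_e, show (-1 : ℤˣ) ≠ 1 by decide]

/-- The sign of the first letter, with default value `ν`. -/
def nextSign (ν : ℤˣ) : List (ℤˣ × G) → ℤˣ
  | [] => ν
  | p :: _ => p.1

/-- The effect of `shift s` on a word that is followed by a letter of sign `ν`. -/
def shiftWord (s : G) (ν : ℤˣ) : List (ℤˣ × G) → List (ℤˣ × G)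
  | [] => []
  | p :: l => (p.1, rightTwist s p.1 * p.2 * leftTwist s (nextSign ν l)) :: shiftWord s ν l

/-- The last coefficient needs the left twist of whatever follows, which $\nu$ supplies. Taking
$\nu=1$ means no twist; taking the word's own first sign treats it as cyclic. -/
theorem shift_wordProd (s : G) (ν : ℤˣ) (l : List (ℤˣ × G)) :
    shift s (wordProd l) * ofBase (leftTwist s ν) =
      ofBase (leftTwist s (nextSign ν l)) * wordProd (shiftWord s ν l) := by
  induction l with
  | nil => simp [nextSign, shiftWord]
  | cons p l ih =>
    simp only [wordProd_cons, map_mul, shift_e_zpow, shift_ofBase, shiftWord, nextSign, mul_assoc,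
      ih]

/-- Only coefficients between opposite signs can cause cancellation, and those are conjugated by $s$
or left unchanged. -/
theorem IsReduced.shiftWord {l : List (ℤˣ × G)} (hl : IsReduced l) (s : G) (ν : ℤˣ) :
    IsReduced (shiftWord s ν l) := by
  induction l with
  | nil => exact List.isChain_nil
  | cons p l ih =>
    cases l with
    | nil => exact List.isChain_singleton _
    | cons q l =>
      rw [IsReduced, List.isChain_cons_cons] at hl
      refine List.isChain_cons_cons.2 ⟨?_, ih hl.2⟩
      have h1 := hl.1
      obtain ⟨ε, g⟩ := p
      obtain ⟨ε', g'⟩ := q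
      simp only [NoCancel, nextSign] at h1 ⊢
      rcases Int.units_eq_one_or ε with rfl | rfl <;>
        rcases Int.units_eq_one_or ε' with rfl | rfl
      · simp
      · simpa [leftTwist, rightTwist, show (-1 : ℤˣ) ≠ 1 by decide, mul_inv_eq_one] using h1
      · simpa [leftTwist, rightTwist, show (-1 : ℤˣ) ≠ 1 by decide] using h1
      · simp

theorem shiftWord_concat (s : G) (μ : ℤˣ) (l : List (ℤˣ × G)) (p : ℤˣ × G) :
    shiftWord s μ (l ++ [p]) =
      shiftWord s p.1 l ++ [(p.1, rightTwist s p.1 * p.2 * leftTwist s μ)] := by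
  induction l with
  | nil => rfl
  | cons q l ih =>
    have : nextSign μ (l ++ [p]) = nextSign p.1 l := by cases l <;> rfl
    simp [shiftWord, ih, this]

/-! ### Elements fixed by two shifts up to base factors -/

/-- Nontrivial elements without a common nontrivial element in their centralizers. -/
def IsIndependent (a c : G) : Prop :=
  a ≠ 1 ∧ c ≠ 1 ∧ ∀ g : G, Commute a g → Commute c g → g = 1

theorem IsIndependent.not_commute {a c : G} (h : IsIndependent a c) : ¬ Commute a c :=
  fun hac => h.2.1 (h.2.2 c hac (Commute.refl c))

/-- If `shift a` and `shift c` multiply `x` from both sides by elements of the base, and the factors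
on each side commute, then `x` belongs to the base. -/
theorem mem_range_of_shift_eq_mul {a c u u' v v' : G} (hac : IsIndependent a c) {x : AdjoinFree G}
    (ha : shift a x = ofBase u * x * ofBase v) (hc : shift c x = ofBase u' * x * ofBase v')
    (hu : Commute u u') (hv : Commute v v') : x ∈ (ofBase : G →* AdjoinFree G).range := by
  obtain ⟨g, l, hl, rfl⟩ := exists_reduced x
  have hshift : ∀ s : G, shift s (ofBase g * wordProd l) =
      ofBase (g * leftTwist s (nextSign 1 l)) * wordProd (shiftWord s 1 l) := by
    intro s
    have h1 := shift_wordProd s 1 l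
    simp only [leftTwist, if_true, map_one, mul_one] at h1
    rw [map_mul, shift_ofBase, h1, ← mul_assoc, ← map_mul]
    rfl
  rw [hshift] at ha hc
  have conj_commute : ∀ {h w w' t t' : G}, w * h = h * t → w' * h = h * t' →
      Commute t t' → Commute w w' := by
    intro h w w' t t' h1 h2 h3
    obtain rfl := eq_mul_inv_of_mul_eq h1
    obtain rfl := eq_mul_inv_of_mul_eq h2
    rw [commute_iff_eq]
    simp only [mul_assoc, inv_mul_cancel_left, mul_right_inj]
    rw [← mul_assoc, h3.eq, mul_assoc]
  match l, hl with
  | [], _ => exact ⟨g, by simp⟩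
  | p :: l, hl =>
    exfalso
    -- the first letter is positive
    have hp : g * leftTwist a p.1 = u * g → g * leftTwist c p.1 = u' * g → p.1 = 1 := by
      intro h1 h2
      by_contra hp
      simp only [leftTwist, if_neg hp] at h1 h2
      -- A negative first letter makes $u,u'$ simultaneous conjugates of $a^{-1},c^{-1}$ by $g$.
      refine hac.not_commute (Commute.inv_inv_iff.1 (conj_commute (h := g⁻¹) (t := u) (t' := u')
        ?_ ?_ hu))
      · rw [eq_inv_mul_iff_mul_eq, ← mul_assoc, h1, mul_inv_cancel_right]
      · rw [eq_inv_mul_iff_mul_eq, ← mul_assoc, h2, mul_inv_cancel_right]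
    rcases List.eq_nil_or_concat l with rfl | ⟨t, ⟨ε, m⟩, rfl⟩
    · have key : ∀ {s w z : G}, ofBase (g * leftTwist s (nextSign 1 [p])) *
          wordProd (shiftWord s 1 [p]) = ofBase w * (ofBase g * wordProd [p]) * ofBase z →
          g * leftTwist s p.1 = w * g ∧ rightTwist s p.1 * p.2 = p.2 * z := by
        intro s w z h
        have h1 : ofBase (g * leftTwist s (nextSign 1 [p])) * wordProd (shiftWord s 1 [p]) =
            ofBase (w * g) * wordProd [(p.1, p.2 * z)] := by
          rw [h]; simp [mul_assoc]
        have h2 := reduced_unique (hl.shiftWord s 1) (List.isChain_singleton _) h1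
        simpa [nextSign, shiftWord, show leftTwist s 1 = 1 from if_pos rfl] using h2
      obtain ⟨ha1, ha2⟩ := key ha
      obtain ⟨hc1, hc2⟩ := key hc
      simp only [hp ha1 hc1, rightTwist, if_true] at ha2 hc2
      -- For a single positive letter, $a$ and $c$ are simultaneous conjugates of $v$ and $v'$,
      -- which commute.
      exact hac.not_commute (conj_commute ha2 hc2 hv)
    · rw [List.concat_eq_append] at *
      -- With at least two letters, the right factor reaches only the last coefficient, so the first
      -- one must be preserved.
      have key : ∀ {s w z : G}, ofBase (g * leftTwist s (nextSign 1 (p :: (t ++ [(ε, m)])))) *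
          wordProd (shiftWord s 1 (p :: (t ++ [(ε, m)]))) =
            ofBase w * (ofBase g * wordProd (p :: (t ++ [(ε, m)]))) * ofBase z →
          g * leftTwist s p.1 = w * g ∧
            rightTwist s p.1 * p.2 * leftTwist s (nextSign 1 (t ++ [(ε, m)])) = p.2 := by
        intro s w z h
        have h1 : ofBase (g * leftTwist s (nextSign 1 (p :: (t ++ [(ε, m)])))) *
            wordProd (shiftWord s 1 (p :: (t ++ [(ε, m)]))) =
            ofBase (w * g) * wordProd (p :: (t ++ [(ε, m * z)])) := by
          rw [h]; simp [mul_assoc]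
        have h2 := reduced_unique (hl.shiftWord s 1)
          ((isReduced_concat_iff (l := p :: t) _).1 hl) h1
        exact ⟨h2.1, congrArg Prod.snd (List.cons.inj h2.2).1⟩
      obtain ⟨ha1, ha2⟩ := key ha
      obtain ⟨hc1, hc2⟩ := key hc
      have hp1 := hp ha1 hc1
      -- A positive second letter would turn the first coefficient into $s$ times itself; a negative
      -- one conjugates it by $s$.
      have hm : ∀ s : G, s ≠ 1 →
          rightTwist s p.1 * p.2 * leftTwist s (nextSign 1 (t ++ [(ε, m)])) = p.2 →
          nextSign 1 (t ++ [(ε, m)]) ≠ 1 ∧ Commute s p.2 := by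
        intro s hs h
        by_cases h1 : nextSign 1 (t ++ [(ε, m)]) = 1
        · simp [h1, leftTwist, rightTwist, hs, hp1] at h
        · refine ⟨h1, ?_⟩
          simpa [h1, hp1, leftTwist, rightTwist, mul_inv_eq_iff_eq_mul, commute_iff_eq] using h
      obtain ⟨hν, hma⟩ := hm a hac.1 ha2
      obtain ⟨-, hmc⟩ := hm c hac.2.1 hc2
      have hm1 := hac.2.2 _ hma hmc
      cases t with
      | nil =>
        rw [IsReduced, List.nil_append, List.isChain_cons_cons] at hl
        exact hν ((hl.1 hm1).symm.trans hp1)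
      | cons q t =>
        rw [IsReduced, List.cons_append, List.isChain_cons_cons] at hl
        exact hν ((hl.1 hm1).symm.trans hp1)

/-- The base consists of the common fixed points of `shift a` and `shift c`. -/
theorem mem_range_of_shift_eq {a c : G} (hac : IsIndependent a c) {x : AdjoinFree G}
    (ha : shift a x = x) (hc : shift c x = x) : x ∈ (ofBase : G →* AdjoinFree G).range :=
  mem_range_of_shift_eq_mul hac (u := 1) (u' := 1) (v := 1) (v' := 1) (by simpa using ha)
    (by simpa using hc) (Commute.refl _) (Commute.refl _)

end AdjoinFree

/-! ### Conjugacy in $G*\langle e\rangle$ and cyclically reduced words -/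

/-- A word `l` that is conjugate to `l'` in the free monoid is a rotation of `l'`. -/
theorem List.isRotated_of_append_eq_append {α : Type*} {l l' : List α} (hl' : l' ≠ []) :
    ∀ {m : List α}, m ++ l = l' ++ m → l ~r l' := by
  intro m
  induction h : m.length using Nat.strong_induction_on generalizing m with
  | _ n ih =>
    intro heq
    -- Either $m$ is a prefix of $l'$ and the rotation is visible, or $l'$ is a prefix of $m$ and
    -- can be stripped from it.
    rcases List.append_eq_append_iff.1 heq with ⟨s, rfl, rfl⟩ | ⟨s, rfl, hs⟩
    · exact List.isRotated_append
    · refine ih s.length ?_ rfl hs.symm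
      have := List.length_pos_iff.2 hl'
      rw [← h, List.length_append]
      omega

namespace AdjoinFree

variable {G : Type*} [Group G]

/-- A cyclic word without cancellation. -/
abbrev IsCyclicallyReduced (l : List (ℤˣ × G)) : Prop := Cycle.Chain NoCancel (l : Cycle (ℤˣ × G))

theorem IsCyclicallyReduced.isRotated {l l' : List (ℤˣ × G)} (h : IsCyclicallyReduced l)
    (hr : l ~r l') : IsCyclicallyReduced l' := by
  have : (l : Cycle (ℤˣ × G)) = l' := Cycle.coe_eq_coe.2 hr
  rw [IsCyclicallyReduced, ← this]
  exact h

theorem IsCyclicallyReduced.isReduced {l : List (ℤˣ × G)} (h : IsCyclicallyReduced l) :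
    IsReduced l := by
  cases l with
  | nil => exact List.isChain_nil
  | cons p l =>
    rw [IsCyclicallyReduced, Cycle.chain_coe_cons, ← List.cons_append] at h
    exact (List.isChain_append.1 h).1

theorem isConj_wordProd_append (l l' : List (ℤˣ × G)) :
    IsConj (wordProd (l ++ l')) (wordProd (l' ++ l)) := by
  rw [isConj_iff]
  exact ⟨(wordProd l)⁻¹, by simp⟩

theorem isConj_wordProd_of_isRotated {l l' : List (ℤˣ × G)} (h : l ~r l') :
    IsConj (wordProd l) (wordProd l') := by
  obtain ⟨n, rfl⟩ := h
  have := isConj_wordProd_append (l.take (n % l.length)) (l.drop (n % l.length))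
  rwa [List.take_append_drop, ← List.rotate_eq_drop_append_take_mod] at this

/-- Conjugation moves the head into the last coefficient. If the last and first letters then cancel
cyclically, conjugation by a power of $e$ removes both, and the word shortens. -/
theorem exists_isConj_of_isReduced (g : G) {l : List (ℤˣ × G)} (hl : IsReduced l) :
    (∃ g' : G, IsConj (ofBase g * wordProd l) (ofBase g')) ∨
      ∃ l' : List (ℤˣ × G), l' ≠ [] ∧ IsCyclicallyReduced l' ∧
        IsConj (ofBase g * wordProd l) (wordProd l') := by
  induction h : l.length using Nat.strong_induction_on generalizing l g with
  | _ n ih =>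
    rcases List.eq_nil_or_concat l with rfl | ⟨l₀, ⟨ε, m⟩, rfl⟩
    · exact Or.inl ⟨g, by rw [wordProd_nil, mul_one]⟩
    rw [List.concat_eq_append] at *
    have hconj : IsConj (ofBase g * wordProd (l₀ ++ [(ε, m)]))
        (wordProd (l₀ ++ [(ε, m * g)])) := by
      rw [isConj_iff]
      exact ⟨(ofBase g)⁻¹, by simp [mul_assoc]⟩
    have hred : IsReduced (l₀ ++ [(ε, m * g)]) := (isReduced_concat_iff _).1 hl
    by_cases hcyc : IsCyclicallyReduced (l₀ ++ [(ε, m * g)])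
    · exact Or.inr ⟨_, by simp, hcyc, hconj⟩
    cases l₀ with
    | nil =>
      refine absurd ?_ hcyc
      simp [IsCyclicallyReduced, Cycle.chain_coe_cons, NoCancel]
    | cons p l₁ =>
      rw [IsCyclicallyReduced, List.cons_append, Cycle.chain_coe_cons, List.append_assoc,
        ← List.cons_append, List.singleton_append, List.isChain_append_cons_cons] at hcyc
      rw [List.cons_append] at hconj hred
      have hpm : ¬ NoCancel (ε, m * g) p := fun hp =>
        hcyc ⟨hred, hp, List.isChain_singleton _⟩
      simp only [NoCancel, Classical.not_imp] at hpm
      obtain ⟨hmg, hεp⟩ := hpm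
      have hε : p.1 = -ε := Int.units_ne_iff_eq_neg.1 fun h => hεp h.symm
      have hconj2 : IsConj (wordProd (p :: (l₁ ++ [(ε, m * g)])))
          (ofBase p.2 * wordProd l₁) := by
        rw [isConj_iff]
        refine ⟨e ^ (ε : ℤ), ?_⟩
        simp [hmg, hε, mul_assoc]
      have hred1 : IsReduced l₁ := (List.isChain_append.1 (List.isChain_cons.1 hred).2).1
      rcases ih l₁.length (by simp at h; omega) p.2 hred1 rfl with ⟨g', hg'⟩ | ⟨l', h1, h2, h3⟩
      · exact Or.inl ⟨g', hconj.trans (hconj2.trans hg')⟩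
      · exact Or.inr ⟨l', h1, h2, hconj.trans (hconj2.trans h3)⟩

/-- Every element is conjugate to an element of the base or to a cyclically reduced word. -/
theorem exists_isConj (x : AdjoinFree G) :
    (∃ g : G, IsConj x (ofBase g)) ∨
      ∃ l : List (ℤˣ × G), l ≠ [] ∧ IsCyclicallyReduced l ∧ IsConj x (wordProd l) := by
  obtain ⟨g, l, hl, rfl⟩ := exists_reduced x
  exact exists_isConj_of_isReduced g hl

/-- A conjugator that cancels against a cyclically reduced word can be shortened at the price of
rotating that word. -/
theorem exists_shorter_conjugator {g : G} {m l : List (ℤˣ × G)} (hm : IsReduced m)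
    (hl : IsCyclicallyReduced l) (hml : ¬ IsReduced (m ++ l)) {y : AdjoinFree G}
    (h : ofBase g * wordProd m * wordProd l = y * (ofBase g * wordProd m)) :
    ∃ (g₁ : G) (m₁ l₁ : List (ℤˣ × G)), IsReduced m₁ ∧ m₁.length < m.length ∧ l ~r l₁ ∧
      ofBase g₁ * wordProd m₁ * wordProd l₁ = y * (ofBase g₁ * wordProd m₁) := by
  rcases List.eq_nil_or_concat m with rfl | ⟨m₀, ⟨ε, k⟩, rfl⟩
  · exact absurd hl.isReduced hml
  rw [List.concat_eq_append] at *
  cases l with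
  | nil => simp [hm] at hml
  | cons p l =>
    rw [List.append_assoc, List.singleton_append, IsReduced, List.isChain_append_cons_cons] at hml
    have hk : ¬ NoCancel (ε, k) p := fun hp => hml ⟨hm, hp, hl.isReduced⟩
    simp only [NoCancel, Classical.not_imp] at hk
    obtain ⟨rfl, hεp⟩ := hk
    have hε : p.1 = -ε := Int.units_ne_iff_eq_neg.1 fun h => hεp h.symm
    -- The last letter of $m$ cancels against $p$. The new conjugator is what remains of the old one
    -- times the coefficient of $p$, and $p$ moves to the end of the cyclic word.
    obtain ⟨g₁, m₁, hm₁, hlen, heq⟩ :=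
      exists_mul_ofBase g p.2 (List.isChain_append.1 hm).1
    refine ⟨g₁, m₁, l ++ [p], hm₁, by simp [hlen], ⟨1, by simp⟩, ?_⟩
    rw [← heq]
    simp only [wordProd_append, wordProd_cons, wordProd_nil, map_one, mul_one, hε, Units.val_neg,
      zpow_neg, ← mul_assoc] at h ⊢
    simp only [mul_assoc, mul_inv_cancel_left] at h ⊢
    simp only [← mul_assoc] at h ⊢
    rw [h]
    simp [mul_assoc]

/-- A cyclically reduced word is not conjugate to an element of the base. -/
theorem not_isConj_ofBase {l : List (ℤˣ × G)} (hl : IsCyclicallyReduced l) (hne : l ≠ []) (g : G) :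
    ¬ IsConj (wordProd l) (ofBase g) := by
  have key : ∀ (n : ℕ) (g₀ : G) (m l : List (ℤˣ × G)), m.length = n → IsReduced m →
      IsCyclicallyReduced l → l ≠ [] →
      ofBase g₀ * wordProd m * wordProd l = ofBase g * (ofBase g₀ * wordProd m) → False := by
    intro n
    induction n using Nat.strong_induction_on with
    | _ n ih =>
      intro g₀ m l hn hm hl hne h
      -- Without cancellation the reduced words $m l$ and $m$ would have equal length.
      by_cases hml : IsReduced (m ++ l)
      · have h1 : ofBase g₀ * wordProd (m ++ l) = ofBase (g * g₀) * wordProd m := by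
          simpa [mul_assoc] using h
        have h2 := congrArg List.length (reduced_unique hml hm h1).2
        have := List.length_pos_iff.2 hne
        rw [List.length_append] at h2
        omega
      · obtain ⟨g₁, m₁, l₁, hm₁, hlt, hr, h1⟩ := exists_shorter_conjugator hm hl hml h
        refine ih m₁.length (hn ▸ hlt) g₁ m₁ l₁ rfl hm₁ (hl.isRotated hr) (fun h0 => hne ?_) h1
        rw [h0] at hr
        exact List.isRotated_nil_iff.1 hr
  intro h
  obtain ⟨c, hc⟩ := isConj_iff.1 h
  obtain ⟨g₀, m, hm, rfl⟩ := exists_reduced c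
  exact key _ g₀ m l rfl hm hl hne (by rw [← hc]; group)

/-- Conjugate cyclically reduced words are rotations of each other. -/
theorem isRotated_of_isConj {l l' : List (ℤˣ × G)} (hl : IsCyclicallyReduced l)
    (hl' : IsCyclicallyReduced l') (hne : l' ≠ []) (h : IsConj (wordProd l) (wordProd l')) :
    l ~r l' := by
  have key : ∀ (n : ℕ) (g₀ : G) (m l l' : List (ℤˣ × G)), m.length = n → IsReduced m →
      IsCyclicallyReduced l → IsCyclicallyReduced l' → l' ≠ [] →
      ofBase g₀ * wordProd m * wordProd l = wordProd l' * (ofBase g₀ * wordProd m) →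
      l ~r l' := by
    intro n
    induction n using Nat.strong_induction_on with
    | _ n ih =>
      intro g₀ m l l' hn hm hl hl' hne h
      by_cases hml : IsReduced (m ++ l)
      swap
      · obtain ⟨g₁, m₁, l₁, hm₁, hlt, hr, h1⟩ := exists_shorter_conjugator hm hl hml h
        exact hr.trans (ih m₁.length (hn ▸ hlt) g₁ m₁ l₁ l' rfl hm₁ (hl.isRotated hr) hl' hne h1)
      obtain ⟨l₀, ⟨ε, k⟩, rfl⟩ := (List.eq_nil_or_concat l').resolve_left hne
      rw [List.concat_eq_append] at *
      -- The head $g_0$ is absorbed into the last coefficient of $l'$. If this side does not cancel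
      -- either, uniqueness gives $g_0=1$ and $ml=l'm$ as words.
      by_cases hlm : IsReduced (l₀ ++ [(ε, k * g₀)] ++ m)
      · have h1 : ofBase g₀ * wordProd (m ++ l) =
            ofBase 1 * wordProd (l₀ ++ [(ε, k * g₀)] ++ m) := by
          simpa [mul_assoc] using h
        obtain ⟨rfl, h2⟩ := reduced_unique hml hlm h1
        rw [mul_one] at h2
        exact List.isRotated_of_append_eq_append hne h2
      -- Cancellation on this side removes the first letter of the conjugator and moves the last
      -- letter of $l'$ to the front.
      · cases m with
        | nil =>
          rw [List.append_nil] at hlm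
          exact absurd ((isReduced_concat_iff _).1 hl'.isReduced) hlm
        | cons p m =>
          rw [List.append_assoc, List.singleton_append, IsReduced,
            List.isChain_append_cons_cons] at hlm
          have hk : ¬ NoCancel (ε, k * g₀) p := fun hp =>
            hlm ⟨(isReduced_concat_iff _).1 hl'.isReduced, hp, hm⟩
          simp only [NoCancel, Classical.not_imp] at hk
          obtain ⟨hkg, hεp⟩ := hk
          have hε : p.1 = -ε := Int.units_ne_iff_eq_neg.1 fun h => hεp h.symm
          have hr : ((ε, k) :: l₀) ~r (l₀ ++ [(ε, k)]) := ⟨1, by simp⟩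
          refine (ih m.length (by rw [← hn]; simp) p.2 m l ((ε, k) :: l₀) rfl
            (List.isChain_cons.1 hm).2 hl (hl'.isRotated hr.symm) (by simp) ?_).trans hr
          obtain rfl : g₀ = k⁻¹ := (inv_eq_of_mul_eq_one_right hkg).symm
          simp only [wordProd_append, wordProd_cons, wordProd_nil, map_inv, mul_one, hε,
            Units.val_neg, zpow_neg, mul_assoc, mul_inv_cancel_left] at h ⊢
          have h2 := congrArg (fun x => e ^ (ε : ℤ) * (ofBase k * x)) h
          simpa [mul_assoc] using h2
  obtain ⟨c, hc⟩ := isConj_iff.1 h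
  obtain ⟨g₀, m, hm, rfl⟩ := exists_reduced c
  exact key _ g₀ m l l' rfl hm hl hl' hne (by rw [← hc]; group)

/-- Appending a copy of the first letter turns the cyclic condition into the linear one, which
shifts preserve. -/
theorem IsCyclicallyReduced.shiftWord {p : ℤˣ × G} {l : List (ℤˣ × G)}
    (h : IsCyclicallyReduced (p :: l)) (s : G) :
    IsCyclicallyReduced (shiftWord s p.1 (p :: l)) := by
  rw [IsCyclicallyReduced, Cycle.chain_coe_cons, ← List.cons_append] at h
  have h1 := IsReduced.shiftWord h s p.1
  rw [shiftWord_concat] at h1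
  rw [AdjoinFree.shiftWord] at h1 ⊢
  rw [IsCyclicallyReduced, Cycle.chain_coe_cons, ← List.cons_append]
  exact (isReduced_concat_iff _).1 h1

theorem isConj_shift_wordProd (s : G) (p : ℤˣ × G) (l : List (ℤˣ × G)) :
    IsConj (shift s (wordProd (p :: l))) (wordProd (shiftWord s p.1 (p :: l))) := by
  have h := shift_wordProd s p.1 (p :: l)
  rw [isConj_iff]
  refine ⟨(ofBase (leftTwist s p.1))⁻¹, ?_⟩
  rw [inv_inv, mul_assoc, h]
  simp [nextSign]

/-! ### Conjugacy classes fixed by shifts -/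

/-- Up to conjugation, the base consists of the elements whose conjugacy classes are fixed by all
powers of `shift a` and `shift c`. -/
theorem exists_isConj_ofBase {a c : G} (htf : IsTorsionFreeGroup G)
    (hab : ∀ g x y : G, g ≠ 1 → Commute g x → Commute g y → Commute x y)
    (hac : IsIndependent a c) {x : AdjoinFree G}
    (ha : ∀ n : ℕ, IsConj (shift (a ^ n) x) x) (hc : ∀ n : ℕ, IsConj (shift (c ^ n) x) x) :
    ∃ g : G, IsConj x (ofBase g) := by
  refine (exists_isConj x).resolve_right ?_
  rintro ⟨l, hne, hl, hx⟩
  -- rotate the word so that it starts with a letter of positive sign, if there is one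
  obtain ⟨p, l', hl', hx', hp⟩ : ∃ (p : ℤˣ × G) (l' : List (ℤˣ × G)),
      IsCyclicallyReduced (p :: l') ∧ IsConj x (wordProd (p :: l')) ∧
        (p.1 = 1 ∨ nextSign p.1 l' ≠ 1) := by
    by_cases hpos : ∃ p ∈ l, p.1 = 1
    · obtain ⟨p, hp, hp1⟩ := hpos
      obtain ⟨l₁, l₂, rfl⟩ := List.append_of_mem hp
      have hr : (l₁ ++ p :: l₂) ~r (p :: (l₂ ++ l₁)) := List.isRotated_append
      exact ⟨p, l₂ ++ l₁, hl.isRotated hr, hx.trans (isConj_wordProd_of_isRotated hr), Or.inl hp1⟩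
    · push Not at hpos
      cases l with
      | nil => exact absurd rfl hne
      | cons p l =>
        refine ⟨p, l, hl, hx, Or.inr ?_⟩
        cases l with
        | nil => exact hpos p (by simp)
        | cons q l => exact hpos q (by simp)
  -- Two equal signs in a row make the coefficient of $p$ become $s^np_2$ or $p_2s^{-n}$, with
  -- pairwise distinct values. The choice of $p$ excludes signs $(-,+)$, so only $(+,-)$ is left.
  have key : ∀ s : G, s ≠ 1 → (∀ n : ℕ, IsConj (shift (s ^ n) x) x) →
      p.1 = 1 ∧ nextSign p.1 l' ≠ 1 ∧ Commute s p.2 := by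
    intro s hs hfix
    have hinj := injective_pow_iff_not_isOfFinOrder.2 (htf s hs)
    have hrot : ∀ n : ℕ, shiftWord (s ^ n) p.1 (p :: l') ∈ {w | w ~r (p :: l')} := by
      intro n
      refine isRotated_of_isConj (hl'.shiftWord _) hl' (by simp) ?_
      have h1 : IsConj (shift (s ^ n) x) (shift (s ^ n) (wordProd (p :: l'))) :=
        MonoidHom.map_isConj (shift (s ^ n)).toMonoidHom hx'
      exact (isConj_shift_wordProd _ _ _).symm.trans (h1.symm.trans ((hfix n).trans hx'))
    have hfin : {w | w ~r (p :: l')}.Finite := by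
      refine (List.finite_toSet (List.cyclicPermutations (p :: l'))).subset fun w hw => ?_
      exact List.mem_cyclicPermutations_iff.2 hw
    -- All the shifted words are rotations of one word, so two powers of $s$ give the same list.
    obtain ⟨i, -, j, -, hij, heq⟩ := Set.infinite_univ.exists_lt_map_eq_of_mapsTo
      (f := fun n : ℕ => shiftWord (s ^ n) p.1 (p :: l')) (fun n _ => hrot n) hfin
    have heq2 := (Prod.mk.injEq _ _ _ _ ▸ (List.cons.inj heq).1 :
      (p.1, rightTwist (s ^ i) p.1 * p.2 * leftTwist (s ^ i) (nextSign p.1 l')) =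
      (p.1, rightTwist (s ^ j) p.1 * p.2 * leftTwist (s ^ j) (nextSign p.1 l')))
    have heq3 := congrArg Prod.snd heq2
    have hne : s ^ i ≠ s ^ j := fun h => hij.ne (hinj h)
    dsimp only at heq3
    by_cases h1 : p.1 = 1
    · by_cases h2 : nextSign p.1 l' = 1
      · simp [h1, h1 ▸ h2, leftTwist, rightTwist, hne] at heq3
      · refine ⟨h1, h2, ?_⟩
        have h3 : s ^ i * p.2 * (s ^ i)⁻¹ = s ^ j * p.2 * (s ^ j)⁻¹ := by
          simpa only [rightTwist, leftTwist, if_neg h2, if_pos h1] using heq3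
        obtain ⟨k, rfl⟩ := Nat.exists_eq_add_of_lt hij
        have h4 : Commute (s ^ (k + 1)) p.2 := by
          rw [add_assoc, pow_add] at h3
          rw [commute_iff_eq, ← mul_inv_eq_iff_eq_mul]
          simp only [mul_inv_rev, mul_assoc, mul_right_inj] at h3
          rw [← mul_assoc p.2 (s ^ (k + 1))⁻¹, ← mul_assoc, mul_left_inj] at h3
          rw [mul_assoc]; exact h3.symm
        -- Commutative transitivity passes from the nontrivial power $s^{k+1}$ to $s$.
        exact hab (s ^ (k + 1)) s p.2 (fun h0 => by
          have := hinj (a₁ := k + 1) (a₂ := 0) (by simpa using h0)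
          omega) ((Commute.refl s).pow_left _) h4
    · have h2 := hp.resolve_left h1
      simp [rightTwist, leftTwist, h1, h2, hne] at heq3
  obtain ⟨hp1, hν, hpa⟩ := key a hac.1 ha
  obtain ⟨-, -, hpc⟩ := key c hac.2.1 hc
  have hp2 := hac.2.2 _ hpa hpc
  cases l' with
  | nil => exact hν hp1
  | cons q l' =>
    have := hl'.isReduced
    rw [IsReduced, List.isChain_cons_cons] at this
    exact hν ((this.1 hp2).symm.trans hp1)

end AdjoinFree

/-! ### Equality of coset classes -/

/-- For a symmetric and transitive relation, equality of classes means equality or relatedness. -/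
theorem Quot.eq_or_rel_of_mk_eq {α : Type*} {r : α → α → Prop} (hs : ∀ x y, r x y → r y x)
    (ht : ∀ x y z, r x y → r y z → r x z) {x y : α} (h : Quot.mk r x = Quot.mk r y) :
    x = y ∨ r x y := by
  have h1 := Quot.eqvGen_exact h
  clear h
  induction h1 with
  | rel x y h => exact Or.inr h
  | refl x => exact Or.inl rfl
  | symm x y _ ih => exact ih.imp Eq.symm (hs _ _)
  | trans x y z _ _ ih1 ih2 =>
    rcases ih1 with rfl | h2
    · exact ih2
    · rcases ih2 with rfl | h3
      · exact Or.inr h2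
      · exact Or.inr (ht _ _ _ h2 h3)

section CosetRelations

variable {G : Type*} [Group G]

/-- Reflexivity may fail where a centralizer is not cyclic. The equivalence generated by the
relation adds only equality, so cyclic centralizers in $H$ are not required. -/
theorem leftCosetRel_eq_or_of_mk_eq {m : ℕ} {x y : G × G}
    (h : Quot.mk (LeftCosetRel G m) x = Quot.mk (LeftCosetRel G m) y) :
    x = y ∨ LeftCosetRel G m x y := by
  refine Quot.eq_or_rel_of_mk_eq ?_ ?_ h
  · rintro x y (⟨h1, h2⟩ | ⟨h1, h2, b, h3, h4, h5⟩)
    · exact Or.inl ⟨h2, h1⟩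
    · exact Or.inr ⟨h2, h1, b, h4, h3, by simpa using inv_mem h5⟩
  · rintro x y z (⟨h1, h2⟩ | ⟨h1, h2, b, h3, h4, h5⟩) (⟨k1, k2⟩ | ⟨k1, k2, b', k3, k4, k5⟩)
    · exact Or.inl ⟨h1, k2⟩
    · exact absurd h2 k1
    · exact absurd k1 h2
    · refine Or.inr ⟨h1, k2, b', h3.trans (h4.symm.trans k3), k4, ?_⟩
      rw [zpowers_pow_eq m (h4.symm.trans k3)] at h5
      simpa [mul_assoc] using mul_mem h5 k5

theorem rightCosetRel_eq_or_of_mk_eq {m : ℕ} {x y : G × G}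
    (h : Quot.mk (RightCosetRel G m) x = Quot.mk (RightCosetRel G m) y) :
    x = y ∨ RightCosetRel G m x y := by
  refine Quot.eq_or_rel_of_mk_eq ?_ ?_ h
  · rintro x y (⟨h1, h2⟩ | ⟨h1, h2, b, h3, h4, h5⟩)
    · exact Or.inl ⟨h2, h1⟩
    · exact Or.inr ⟨h2, h1, b, h4, h3, by simpa using inv_mem h5⟩
  · rintro x y z (⟨h1, h2⟩ | ⟨h1, h2, b, h3, h4, h5⟩) (⟨k1, k2⟩ | ⟨k1, k2, b', k3, k4, k5⟩)
    · exact Or.inl ⟨h1, k2⟩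
    · exact absurd h2 k1
    · exact absurd k1 h2
    · refine Or.inr ⟨h1, k2, b', h3.trans (h4.symm.trans k3), k4, ?_⟩
      rw [zpowers_pow_eq m (h4.symm.trans k3)] at h5
      simpa [mul_assoc] using mul_mem h5 k5

theorem doubleCosetRel_eq_or_of_mk_eq {m n : ℕ} {x y : G × G × G}
    (h : Quot.mk (DoubleCosetRel G m n) x = Quot.mk (DoubleCosetRel G m n) y) :
    x = y ∨ DoubleCosetRel G m n x y := by
  refine Quot.eq_or_rel_of_mk_eq ?_ ?_ h
  · rintro x y (⟨h1, h2⟩ | ⟨h1, h2, h3, h4, a, c, h5, h6, h7, h8, γ, hγ, ε, hε, h9⟩)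
    · exact Or.inl ⟨h2, h1⟩
    · refine Or.inr ⟨h3, h4, h1, h2, a, c, h6, h5, h8, h7, γ⁻¹, inv_mem hγ, ε⁻¹, inv_mem hε, ?_⟩
      rw [← h9]
      group
  · rintro x y z (⟨h1, h2⟩ | ⟨h1, h2, h3, h4, a, c, h5, h6, h7, h8, γ, hγ, ε, hε, h9⟩)
      (⟨k1, k2⟩ | ⟨k1, k2, k3, k4, a', c', k5, k6, k7, k8, γ', kγ, ε', kε, k9⟩)
    · exact Or.inl ⟨h1, k2⟩
    · exact absurd h2 (not_or.2 ⟨k1, k2⟩)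
    · exact absurd k1 (not_or.2 ⟨h3, h4⟩)
    · rw [zpowers_pow_eq m (h6.symm.trans k5)] at hγ
      rw [zpowers_pow_eq n (h8.symm.trans k7)] at hε
      refine Or.inr ⟨h1, h2, k3, k4, a', c', h5.trans (h6.symm.trans k5), k6,
        h7.trans (h8.symm.trans k7), k8, γ' * γ, mul_mem kγ hγ, ε * ε', mul_mem hε kε, ?_⟩
      rw [← k9, ← h9]
      group

theorem zpowers_pow_le (b : G) (m : ℕ) : Subgroup.zpowers (b ^ m) ≤ Subgroup.zpowers b :=
  Subgroup.zpowers_le.2 (pow_mem (Subgroup.mem_zpowers b) m)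

theorem mem_elemCentralizer_self (g : G) : g ∈ elemCentralizer g :=
  Subgroup.mem_centralizer_singleton_iff.2 rfl

theorem finite_setOf_zpowers_eq (b : G) :
    {z : G | Subgroup.zpowers z = Subgroup.zpowers b}.Finite := by
  by_cases hb : IsOfFinOrder b
  · have : (Subgroup.zpowers b : Set G).Finite := hb.finite_zpowers
    refine this.subset fun z hz => ?_
    have hz : Subgroup.zpowers z = Subgroup.zpowers b := hz
    rw [SetLike.mem_coe, ← hz]
    exact Subgroup.mem_zpowers z
  · refine ((Set.finite_singleton b⁻¹).insert b).subset fun z hz => ?_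
    rcases (Subgroup.zpowers_eq_zpowers_iff hb).1 hz.symm with rfl | h
    · exact Or.inl rfl
    · exact Or.inr (by rw [Set.mem_singleton_iff, ← h])

end CosetRelations

/-! ### Infinite orbits under two shifts -/

namespace AdjoinFree

variable {G : Type*} [Group G]

theorem IsIndependent.pow {a c : G} (htf : IsTorsionFreeGroup G)
    (hab : ∀ g x y : G, g ≠ 1 → Commute g x → Commute g y → Commute x y)
    (h : IsIndependent a c) {k l : ℕ} (hk : 0 < k) (hl : 0 < l) :
    IsIndependent (a ^ k) (c ^ l) := by
  have hne : ∀ {s : G} {n : ℕ}, s ≠ 1 → 0 < n → s ^ n ≠ 1 := fun hs hn h0 =>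
    htf _ hs (isOfFinOrder_iff_pow_eq_one.2 ⟨_, hn, h0⟩)
  refine ⟨hne h.1 hk, hne h.2.1 hl, fun g h1 h2 => h.2.2 g ?_ ?_⟩
  · exact hab (a ^ k) a g (hne h.1 hk) ((Commute.refl a).pow_left k) h1
  · exact hab (c ^ l) c g (hne h.2.1 hl) ((Commute.refl c).pow_left l) h2

/-- If all powers of `shift s` preserve `⟨b⟩`, then one of them fixes `b`. -/
theorem exists_shift_pow_eq {s : G} {b : AdjoinFree G}
    (h : ∀ n : ℕ, Subgroup.zpowers (shift (s ^ n) b) = Subgroup.zpowers b) :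
    ∃ k : ℕ, 0 < k ∧ shift (s ^ k) b = b := by
  obtain ⟨i, -, j, -, hij, heq⟩ := Set.infinite_univ.exists_lt_map_eq_of_mapsTo
    (f := fun n : ℕ => shift (s ^ n) b) (fun n _ => h n) (finite_setOf_zpowers_eq b)
  obtain ⟨k, rfl⟩ := Nat.exists_eq_add_of_lt hij
  refine ⟨k + 1, Nat.succ_pos k, ?_⟩
  rw [← shift_pow, ← shift_pow, add_assoc, pow_add, MulAut.mul_apply] at heq
  rw [← shift_pow]
  exact ((shift s ^ i).injective heq).symm

/-- Some positive powers of the two shifts fix $b$ itself, and they are shifts by independent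
elements again. This is applied to generators of centralizers. -/
theorem generator_mem_range {a c : G} (htf : IsTorsionFreeGroup G)
    (hab : ∀ g x y : G, g ≠ 1 → Commute g x → Commute g y → Commute x y)
    (hac : IsIndependent a c) {b : AdjoinFree G}
    (ha : ∀ n : ℕ, Subgroup.zpowers (shift (a ^ n) b) = Subgroup.zpowers b)
    (hc : ∀ n : ℕ, Subgroup.zpowers (shift (c ^ n) b) = Subgroup.zpowers b) :
    ∃ b₀ : G, b = ofBase b₀ := by
  obtain ⟨k, hk, hk'⟩ := exists_shift_pow_eq ha
  obtain ⟨l, hl, hl'⟩ := exists_shift_pow_eq hc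
  obtain ⟨b₀, hb₀⟩ := mem_range_of_shift_eq (hac.pow htf hab hk hl) hk' hl'
  exact ⟨b₀, hb₀.symm⟩

theorem exists_ofBase_zpow {b₀ : G} {m : ℕ} {b z : AdjoinFree G}
    (hb : Subgroup.zpowers (ofBase b₀) = Subgroup.zpowers b) (hz : z ∈ Subgroup.zpowers (b ^ m)) :
    ∃ i : ℤ, z = ofBase (b₀ ^ i) := by
  have h1 := zpowers_pow_le _ _ hz
  rw [← hb] at h1
  obtain ⟨i, hi⟩ := Subgroup.mem_zpowers_iff.1 h1
  exact ⟨i, by rw [map_zpow, hi]⟩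

/-- An element of `H^we` that is fixed by all powers of `shift a` and `shift c` comes from the
base. -/
theorem comesFrom_of_smul_eq {a c : G} (htf : IsTorsionFreeGroup G)
    (hab : ∀ g x y : G, g ≠ 1 → Commute g x → Commute g y → Commute x y)
    (hac : IsIndependent a c) {β : WE (AdjoinFree G)} (ha : ∀ n : ℕ, shift (a ^ n) • β = β)
    (hc : ∀ n : ℕ, shift (c ^ n) • β = β) : β.ComesFrom ofBase := by
  have hfix : ∀ {x : AdjoinFree G}, shift (a ^ 1) x = x → shift (c ^ 1) x = x →
      ∃ g : G, x = ofBase g := by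
    intro x h1 h2
    rw [pow_one] at h1 h2
    obtain ⟨g, hg⟩ := mem_range_of_shift_eq hac h1 h2
    exact ⟨g, hg.symm⟩
  obtain x | ⟨⟨x⟩⟩ | ⟨m, ⟨x, y⟩⟩ | ⟨m, ⟨x, y⟩⟩ | ⟨m, n, ⟨p, q, r⟩⟩ := β
  · obtain ⟨g, rfl⟩ := hfix (WE.home.inj (ha 1)) (WE.home.inj (hc 1))
    exact .home g
  · obtain ⟨g, hg⟩ := exists_isConj_ofBase htf hab hac
      (fun n => ConjClasses.mk_eq_mk_iff_isConj.1 (WE.conj.inj (ha n)))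
      (fun n => ConjClasses.mk_eq_mk_iff_isConj.1 (WE.conj.inj (hc n)))
    have : WE.conj (Quot.mk _ x) = WE.conj (ConjClasses.mk (ofBase g)) :=
      congrArg WE.conj (ConjClasses.mk_eq_mk_iff_isConj.2 hg)
    rw [this]
    exact .conj g
  · by_cases hy : y = 1
    · have : Quot.mk (LeftCosetRel (AdjoinFree G) m) (x, y) = Quot.mk _ (ofBase 1, ofBase 1) :=
        Quot.sound (Or.inl ⟨hy, map_one _⟩)
      rw [this]
      exact .leftCoset m 1 1
    have hrel : ∀ s : G, shift s • WE.leftCoset m (Quot.mk _ (x, y)) =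
        WE.leftCoset m (Quot.mk _ (x, y)) → (x, y) = (shift s x, shift s y) ∨
          LeftCosetRel (AdjoinFree G) m (x, y) (shift s x, shift s y) := fun s h =>
      leftCosetRel_eq_or_of_mk_eq (eq_of_heq (WE.leftCoset.inj h).2).symm
    -- If the centralizer is cyclic, the shifts preserve $\langle b\rangle$, so $b$ and its power
    -- $y$ lie in $G$. If not, the class is a single pair and both entries are fixed.
    by_cases hcyc : ∃ b, elemCentralizer y = Subgroup.zpowers b
    · obtain ⟨b, hb⟩ := hcyc
      have hrel' : ∀ s : G, shift s • WE.leftCoset m (Quot.mk _ (x, y)) =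
          WE.leftCoset m (Quot.mk _ (x, y)) →
          Subgroup.zpowers (shift s b) = Subgroup.zpowers b ∧
            x⁻¹ * shift s x ∈ Subgroup.zpowers (b ^ m) := by
        intro s h
        rcases hrel s h with h1 | ⟨h1, -⟩ | ⟨-, -, b', h1, h2, h3⟩
        · obtain ⟨h2, h3⟩ := Prod.mk.inj h1
          refine ⟨?_, by rw [← h2]; simp⟩
          rw [← elemCentralizer_map _ hb, ← h3, hb]
        · exact absurd h1 hy
        · refine ⟨?_, ?_⟩
          · rw [← elemCentralizer_map _ hb, h2, ← h1, hb]
          · rw [zpowers_pow_eq m (hb.symm.trans h1)]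
            exact h3
      obtain ⟨b₀, rfl⟩ := generator_mem_range htf hab hac (fun n => (hrel' _ (ha n)).1)
        (fun n => (hrel' _ (hc n)).1)
      have hy' := mem_elemCentralizer_self y
      rw [hb] at hy'
      obtain ⟨j, rfl⟩ := exists_ofBase_zpow (m := 1) rfl (by simpa using hy')
      obtain ⟨i, hi⟩ := exists_ofBase_zpow rfl (hrel' _ (ha 1)).2
      obtain ⟨i', hi'⟩ := exists_ofBase_zpow rfl (hrel' _ (hc 1)).2
      rw [pow_one, inv_mul_eq_iff_eq_mul] at hi hi'
      -- Both right factors are powers of the same $b_0$, hence commute.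
      obtain ⟨g, rfl⟩ := mem_range_of_shift_eq_mul hac (u := 1) (u' := 1) (by simpa using hi)
        (by simpa using hi') (Commute.refl _) (Commute.zpow_zpow_self _ _ _)
      exact .leftCoset m g _
    · have hrel' : ∀ s : G, shift s • WE.leftCoset m (Quot.mk _ (x, y)) =
          WE.leftCoset m (Quot.mk _ (x, y)) → shift s x = x ∧ shift s y = y := by
        intro s h
        rcases hrel s h with h1 | ⟨h1, -⟩ | ⟨-, -, b', h1, -⟩
        · exact ⟨(Prod.mk.inj h1).1.symm, (Prod.mk.inj h1).2.symm⟩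
        · exact absurd h1 hy
        · exact absurd ⟨b', h1⟩ hcyc
      obtain ⟨g, rfl⟩ := hfix (hrel' _ (ha 1)).1 (hrel' _ (hc 1)).1
      obtain ⟨g', rfl⟩ := hfix (hrel' _ (ha 1)).2 (hrel' _ (hc 1)).2
      exact .leftCoset m g g'
  · by_cases hy : y = 1
    · have : Quot.mk (RightCosetRel (AdjoinFree G) m) (x, y) = Quot.mk _ (ofBase 1, ofBase 1) :=
        Quot.sound (Or.inl ⟨hy, map_one _⟩)
      rw [this]
      exact .rightCoset m 1 1
    have hrel : ∀ s : G, shift s • WE.rightCoset m (Quot.mk _ (x, y)) =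
        WE.rightCoset m (Quot.mk _ (x, y)) → (x, y) = (shift s x, shift s y) ∨
          RightCosetRel (AdjoinFree G) m (x, y) (shift s x, shift s y) := fun s h =>
      rightCosetRel_eq_or_of_mk_eq (eq_of_heq (WE.rightCoset.inj h).2).symm
    by_cases hcyc : ∃ b, elemCentralizer y = Subgroup.zpowers b
    · obtain ⟨b, hb⟩ := hcyc
      have hrel' : ∀ s : G, shift s • WE.rightCoset m (Quot.mk _ (x, y)) =
          WE.rightCoset m (Quot.mk _ (x, y)) →
          Subgroup.zpowers (shift s b) = Subgroup.zpowers b ∧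
            shift s x * x⁻¹ ∈ Subgroup.zpowers (b ^ m) := by
        intro s h
        rcases hrel s h with h1 | ⟨h1, -⟩ | ⟨-, -, b', h1, h2, h3⟩
        · obtain ⟨h2, h3⟩ := Prod.mk.inj h1
          refine ⟨?_, by rw [← h2]; simp⟩
          rw [← elemCentralizer_map _ hb, ← h3, hb]
        · exact absurd h1 hy
        · refine ⟨?_, ?_⟩
          · rw [← elemCentralizer_map _ hb, h2, ← h1, hb]
          · rw [zpowers_pow_eq m (hb.symm.trans h1)]
            simpa using inv_mem h3
      obtain ⟨b₀, rfl⟩ := generator_mem_range htf hab hac (fun n => (hrel' _ (ha n)).1)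
        (fun n => (hrel' _ (hc n)).1)
      have hy' := mem_elemCentralizer_self y
      rw [hb] at hy'
      obtain ⟨j, rfl⟩ := exists_ofBase_zpow (m := 1) rfl (by simpa using hy')
      obtain ⟨i, hi⟩ := exists_ofBase_zpow rfl (hrel' _ (ha 1)).2
      obtain ⟨i', hi'⟩ := exists_ofBase_zpow rfl (hrel' _ (hc 1)).2
      rw [pow_one, mul_inv_eq_iff_eq_mul] at hi hi'
      obtain ⟨g, rfl⟩ := mem_range_of_shift_eq_mul hac (v := 1) (v' := 1) (by simpa using hi)
        (by simpa using hi') (Commute.zpow_zpow_self _ _ _) (Commute.refl _)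
      exact .rightCoset m g _
    · have hrel' : ∀ s : G, shift s • WE.rightCoset m (Quot.mk _ (x, y)) =
          WE.rightCoset m (Quot.mk _ (x, y)) → shift s x = x ∧ shift s y = y := by
        intro s h
        rcases hrel s h with h1 | ⟨h1, -⟩ | ⟨-, -, b', h1, -⟩
        · exact ⟨(Prod.mk.inj h1).1.symm, (Prod.mk.inj h1).2.symm⟩
        · exact absurd h1 hy
        · exact absurd ⟨b', h1⟩ hcyc
      obtain ⟨g, rfl⟩ := hfix (hrel' _ (ha 1)).1 (hrel' _ (hc 1)).1
      obtain ⟨g', rfl⟩ := hfix (hrel' _ (ha 1)).2 (hrel' _ (hc 1)).2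
      exact .rightCoset m g g'
  · by_cases hpr : p = 1 ∨ r = 1
    · have : Quot.mk (DoubleCosetRel (AdjoinFree G) m n) (p, q, r) =
          Quot.mk _ (ofBase 1, ofBase 1, ofBase 1) :=
        Quot.sound (Or.inl ⟨hpr, Or.inl (map_one _)⟩)
      rw [this]
      exact .doubleCoset m n 1 1 1
    have hrel : ∀ s : G, shift s • WE.doubleCoset m n (Quot.mk _ (p, q, r)) =
        WE.doubleCoset m n (Quot.mk _ (p, q, r)) →
        (p, q, r) = (shift s p, shift s q, shift s r) ∨
          DoubleCosetRel (AdjoinFree G) m n (p, q, r) (shift s p, shift s q, shift s r) :=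
      fun s h => doubleCosetRel_eq_or_of_mk_eq (eq_of_heq (WE.doubleCoset.inj h).2.2).symm
    by_cases hcyc : (∃ b, elemCentralizer p = Subgroup.zpowers b) ∧
        ∃ d, elemCentralizer r = Subgroup.zpowers d
    · obtain ⟨⟨b, hb⟩, d, hd⟩ := hcyc
      have hrel' : ∀ s : G, shift s • WE.doubleCoset m n (Quot.mk _ (p, q, r)) =
          WE.doubleCoset m n (Quot.mk _ (p, q, r)) →
          Subgroup.zpowers (shift s b) = Subgroup.zpowers b ∧
          Subgroup.zpowers (shift s d) = Subgroup.zpowers d ∧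
            ∃ γ ∈ Subgroup.zpowers (b ^ m), ∃ ε ∈ Subgroup.zpowers (d ^ n),
              shift s q = γ * q * ε := by
        intro s h
        rcases hrel s h with h1 | ⟨h1, -⟩ | ⟨-, -, -, -, b', d', h1, h2, h3, h4, γ, hγ, ε, hε, h5⟩
        · obtain ⟨h2, h3⟩ := Prod.mk.inj h1
          obtain ⟨h3, h4⟩ := Prod.mk.inj h3
          refine ⟨?_, ?_, 1, one_mem _, 1, one_mem _, by rw [← h3]; simp⟩
          · rw [← elemCentralizer_map _ hb, ← h2, hb]
          · rw [← elemCentralizer_map _ hd, ← h4, hd]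
        · exact absurd h1 hpr
        · refine ⟨?_, ?_, γ, ?_, ε, ?_, h5.symm⟩
          · rw [← elemCentralizer_map _ hb, h2, ← h1, hb]
          · rw [← elemCentralizer_map _ hd, h4, ← h3, hd]
          · rwa [zpowers_pow_eq m (hb.symm.trans h1)]
          · rwa [zpowers_pow_eq n (hd.symm.trans h3)]
      obtain ⟨b₀, rfl⟩ := generator_mem_range htf hab hac (fun n => (hrel' _ (ha n)).1)
        (fun n => (hrel' _ (hc n)).1)
      obtain ⟨d₀, rfl⟩ := generator_mem_range htf hab hac (fun n => (hrel' _ (ha n)).2.1)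
        (fun n => (hrel' _ (hc n)).2.1)
      have hp' := mem_elemCentralizer_self p
      rw [hb] at hp'
      obtain ⟨j, rfl⟩ := exists_ofBase_zpow (m := 1) rfl (by simpa using hp')
      have hr' := mem_elemCentralizer_self r
      rw [hd] at hr'
      obtain ⟨j', rfl⟩ := exists_ofBase_zpow (m := 1) rfl (by simpa using hr')
      obtain ⟨-, -, γ, hγ, ε, hε, hq⟩ := hrel' _ (ha 1)
      obtain ⟨-, -, γ', hγ', ε', hε', hq'⟩ := hrel' _ (hc 1)
      obtain ⟨i₁, rfl⟩ := exists_ofBase_zpow rfl hγ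
      obtain ⟨i₂, rfl⟩ := exists_ofBase_zpow rfl hε
      obtain ⟨i₃, rfl⟩ := exists_ofBase_zpow rfl hγ'
      obtain ⟨i₄, rfl⟩ := exists_ofBase_zpow rfl hε'
      rw [pow_one] at hq hq'
      -- The left factors are powers of $b_0$ and the right factors powers of $d_0$, so they commute
      -- on each side.
      obtain ⟨g, rfl⟩ := mem_range_of_shift_eq_mul hac hq hq' (Commute.zpow_zpow_self _ _ _)
        (Commute.zpow_zpow_self _ _ _)
      exact .doubleCoset m n _ g _
    · have hrel' : ∀ s : G, shift s • WE.doubleCoset m n (Quot.mk _ (p, q, r)) =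
          WE.doubleCoset m n (Quot.mk _ (p, q, r)) →
          shift s p = p ∧ shift s q = q ∧ shift s r = r := by
        intro s h
        rcases hrel s h with h1 | ⟨h1, -⟩ | ⟨-, -, -, -, b', d', h1, -, h2, -⟩
        · obtain ⟨h2, h3⟩ := Prod.mk.inj h1
          obtain ⟨h3, h4⟩ := Prod.mk.inj h3
          exact ⟨h2.symm, h3.symm, h4.symm⟩
        · exact absurd h1 hpr
        · exact absurd ⟨⟨b', h1⟩, d', h2⟩ hcyc
      obtain ⟨g, rfl⟩ := hfix (hrel' _ (ha 1)).1 (hrel' _ (hc 1)).1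
      obtain ⟨g', rfl⟩ := hfix (hrel' _ (ha 1)).2.1 (hrel' _ (hc 1)).2.1
      obtain ⟨g'', rfl⟩ := hfix (hrel' _ (ha 1)).2.2 (hrel' _ (hc 1)).2.2
      exact .doubleCoset m n g g' g''

theorem exists_pow_smul_eq_of_finite_orbit {Γ X : Type*} [Group Γ] [MulAction Γ X] {x : X}
    (h : (MulAction.orbit Γ x).Finite) (f : Γ) : ∃ k : ℕ, 0 < k ∧ f ^ k • x = x := by
  obtain ⟨i, -, j, -, hij, heq⟩ := Set.infinite_univ.exists_lt_map_eq_of_mapsTo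
    (f := fun n : ℕ => f ^ n • x) (fun n _ => MulAction.mem_orbit x (f ^ n)) h
  obtain ⟨k, rfl⟩ := Nat.exists_eq_add_of_lt hij
  refine ⟨k + 1, Nat.succ_pos k, ?_⟩
  simp only [add_assoc, pow_add _ i, mul_smul] at heq
  exact (MulAction.injective (f ^ i) heq).symm

theorem infinite_orbit_closure_shift {a c : G} (htf : IsTorsionFreeGroup G)
    (hab : ∀ g x y : G, g ≠ 1 → Commute g x → Commute g y → Commute x y)
    (hac : IsIndependent a c) {β : WE (AdjoinFree G)} (hβ : ¬ β.ComesFrom ofBase) :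
    (MulAction.orbit (Subgroup.closure {shift a, shift c}) β).Infinite := by
  intro hfin
  have key : ∀ s : G, shift s ∈ Subgroup.closure {shift a, shift c} →
      ∃ k : ℕ, 0 < k ∧ ∀ n : ℕ, shift ((s ^ k) ^ n) • β = β := by
    intro s hs
    obtain ⟨k, hk, h⟩ := exists_pow_smul_eq_of_finite_orbit hfin ⟨shift s, hs⟩
    refine ⟨k, hk, fun n => ?_⟩
    have h1 : shift (s ^ k) • β = β := by
      rw [← shift_pow]
      exact h
    rw [← shift_pow]
    induction n with
    | zero => rw [pow_zero, one_smul]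
    | succ n ih => rw [pow_succ, mul_smul, h1, ih]
  obtain ⟨k, hk, h1⟩ := key a (Subgroup.subset_closure (by simp))
  obtain ⟨l, hl, h2⟩ := key c (Subgroup.subset_closure (by simp))
  exact hβ (comesFrom_of_smul_eq htf hab (hac.pow htf hab hk hl) h1 h2)

/-- A common nontrivial commuting element would make $a$ and $c$ commute, and by commutative
transitivity their centralizers would agree. -/
theorem isIndependent_of_elemCentralizer_ne {a c : G}
    (hab : ∀ g x y : G, g ≠ 1 → Commute g x → Commute g y → Commute x y) (ha : a ≠ 1) (hc : c ≠ 1)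
    (h : elemCentralizer a ≠ elemCentralizer c) : IsIndependent a c := by
  refine ⟨ha, hc, fun g h1 h2 => ?_⟩
  by_contra hg
  have hac : Commute a c := hab g a c hg h1.symm h2.symm
  refine h (Subgroup.ext fun x => ?_)
  rw [Subgroup.mem_centralizer_singleton_iff, Subgroup.mem_centralizer_singleton_iff]
  exact ⟨fun hx => hab a x c ha (commute_iff_eq _ _ |>.2 hx).symm hac,
    fun hx => hab c x a hc (commute_iff_eq _ _ |>.2 hx).symm hac.symm⟩

end AdjoinFree

/-! ### Conjugacy in a group generated by two factors -/

/-- The product `b₁ * a₁ * ⋯ * bₖ * aₖ` of a list of pairs `(bᵢ, aᵢ)`. -/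
def Subgroup.pairsProd {G : Type*} [Group G] {A B : Subgroup G} (l : List (B × A)) : G :=
  (l.map fun p => (p.1 : G) * p.2).prod

namespace Subgroup

variable {G : Type*} [Group G] {A B : Subgroup G}

@[simp] theorem pairsProd_nil : pairsProd ([] : List (B × A)) = 1 := rfl

@[simp] theorem pairsProd_cons (p : B × A) (l : List (B × A)) :
    pairsProd (p :: l) = p.1 * p.2 * pairsProd l := by
  simp [pairsProd]

@[simp] theorem pairsProd_append (l l' : List (B × A)) :
    pairsProd (l ++ l') = pairsProd l * pairsProd l' := by
  simp [pairsProd]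

/-- A product of elements of two subgroups is conjugate to an element of one of them or to an
alternating product without trivial factors. -/
theorem isConj_pairsProd (l : List (B × A)) :
    (∃ x : G, (x ∈ A ∨ x ∈ B) ∧ IsConj (pairsProd l) x) ∨
      ∃ l' : List (B × A), l' ≠ [] ∧ (∀ p ∈ l', p.1 ≠ 1 ∧ p.2 ≠ 1) ∧
        IsConj (pairsProd l) (pairsProd l') := by
  induction h : l.length using Nat.strong_induction_on generalizing l with
  | _ n ih =>
    by_cases hne : l = []
    · subst hne
      exact Or.inl ⟨1, Or.inl A.one_mem, IsConj.refl _⟩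
    by_cases hall : ∀ p ∈ l, p.1 ≠ 1 ∧ p.2 ≠ 1
    · exact Or.inr ⟨l, hne, hall, IsConj.refl _⟩
    push Not at hall
    obtain ⟨p, hp, hp1⟩ := hall
    obtain ⟨l₁, l₂, rfl⟩ := List.append_of_mem hp
    have hrot : IsConj (pairsProd (l₁ ++ p :: l₂)) (pairsProd (p :: (l₂ ++ l₁))) := by
      rw [isConj_iff]
      exact ⟨(pairsProd l₁)⁻¹, by simp [mul_assoc]⟩
    have hlen : (l₂ ++ l₁).length + 1 = n := by rw [← h]; simp; omega
    generalize l₂ ++ l₁ = r at hrot hlen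
    -- A pair with a trivial entry merges with its cyclic neighbour; with no neighbour left, the
    -- product lies in one factor.
    obtain ⟨r', hr', hconj⟩ | hconj : (∃ r' : List (B × A), r'.length = r.length ∧
        IsConj (pairsProd (p :: r)) (pairsProd r')) ∨
        ∃ x : G, (x ∈ A ∨ x ∈ B) ∧ IsConj (pairsProd (p :: r)) x := by
      by_cases hb : p.1 = 1
      · rcases List.eq_nil_or_concat r with rfl | ⟨r₀, q, rfl⟩
        · exact Or.inr ⟨p.2, Or.inl p.2.2, by
            rw [show pairsProd [p] = p.2 by simp [hb]]⟩
        · refine Or.inl ⟨r₀ ++ [(q.1, q.2 * p.2)], by simp, ?_⟩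
          rw [isConj_iff]
          exact ⟨(p.2 : G)⁻¹, by simp [hb, mul_assoc]⟩
      · have ha := hp1 hb
        cases r with
        | nil => exact Or.inr ⟨p.1, Or.inr p.1.2, by
            rw [show pairsProd [p] = p.1 by simp [ha]]⟩
        | cons q r =>
          refine Or.inl ⟨(p.1 * q.1, q.2) :: r, by simp, ?_⟩
          rw [show pairsProd (p :: q :: r) = pairsProd ((p.1 * q.1, q.2) :: r) by
            simp [ha, mul_assoc]]
    · rcases ih r'.length (by omega) r' rfl with ⟨x, hx, h1⟩ | ⟨l', h1, h2, h3⟩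
      · exact Or.inl ⟨x, hx, hrot.trans (hconj.trans h1)⟩
      · exact Or.inr ⟨l', h1, h2, hrot.trans (hconj.trans h3)⟩
    · obtain ⟨x, hx, h1⟩ := hconj
      exact Or.inl ⟨x, hx, hrot.trans h1⟩

theorem exists_pairsProd_eq (h : Function.Surjective (Monoid.Coprod.lift A.subtype B.subtype))
    (x : G) : ∃ l : List (B × A), x = pairsProd l := by
  obtain ⟨z, rfl⟩ := h x
  induction z using Monoid.Coprod.induction_on with
  | inl a => exact ⟨[(1, a)], by simp⟩
  | inr b => exact ⟨[(b, 1)], by simp⟩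
  | mul y z hy hz =>
    obtain ⟨l, hl⟩ := hy
    obtain ⟨l', hl'⟩ := hz
    exact ⟨l ++ l', by rw [map_mul, hl, hl', pairsProd_append]⟩

end Subgroup

/-! ### Moving elements out of $G^{we}$ when $G=A*B$ -/

namespace AdjoinFree

variable {G : Type*} [Group G] {A B : Subgroup G}

/-- For `G = A * B`, the endomorphism of `G * ⟨e⟩` that is the identity on `A` and `⟨e⟩` and
conjugation by `d` on `B`. -/
noncomputable def factorConjHom
    (h : Function.Bijective (Monoid.Coprod.lift A.subtype B.subtype)) (d : AdjoinFree G) :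
    AdjoinFree G →* AdjoinFree G :=
  Monoid.Coprod.lift
    ((Monoid.Coprod.lift (ofBase.comp A.subtype)
      ((MulAut.conj d).toMonoidHom.comp (ofBase.comp B.subtype))).comp
        (MulEquiv.ofBijective _ h).symm.toMonoidHom)
    (zpowersHom _ e)

variable (h : Function.Bijective (Monoid.Coprod.lift A.subtype B.subtype))

theorem factorConjHom_left (d : AdjoinFree G) (a : A) :
    factorConjHom h d (ofBase (a : G)) = ofBase (a : G) := by
  have h1 : (MulEquiv.ofBijective _ h).symm (a : G) = Monoid.Coprod.inl a := by
    rw [MulEquiv.symm_apply_eq]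
    simp
  simp [factorConjHom, AdjoinFree.ofBase, h1]

theorem factorConjHom_right (d : AdjoinFree G) (b : B) :
    factorConjHom h d (ofBase (b : G)) = d * ofBase (b : G) * d⁻¹ := by
  have h1 : (MulEquiv.ofBijective _ h).symm (b : G) = Monoid.Coprod.inr b := by
    rw [MulEquiv.symm_apply_eq]
    simp
  simp [factorConjHom, AdjoinFree.ofBase, h1]

theorem factorConjHom_e (d : AdjoinFree G) : factorConjHom h d e = e := by
  simp [factorConjHom, AdjoinFree.e]

theorem factorConjHom_comp {d d' : AdjoinFree G} (hd : factorConjHom h d d' = d')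
    (hdd' : d' * d = 1) : (factorConjHom h d).comp (factorConjHom h d') = MonoidHom.id _ := by
  refine Monoid.Coprod.hom_ext ?_ (MonoidHom.ext_mint ?_)
  · ext g
    obtain ⟨l, rfl⟩ := Subgroup.exists_pairsProd_eq h.surjective g
    change factorConjHom h d (factorConjHom h d' (ofBase _)) = ofBase _
    induction l with
    | nil => simp
    | cons p l ih =>
      have h1 : factorConjHom h d (factorConjHom h d' (ofBase (p.1 : G))) = ofBase (p.1 : G) := by
        rw [factorConjHom_right]
        simp only [map_mul, map_inv, hd, factorConjHom_right]
        rw [eq_inv_of_mul_eq_one_left hdd']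
        group
      simp only [Subgroup.pairsProd_cons, map_mul, factorConjHom_left, h1, ih]
  · change factorConjHom h d (factorConjHom h d' e) = e
    rw [factorConjHom_e, factorConjHom_e]

/-- For `G = A * B`, the automorphism of `G * ⟨e⟩` that is the identity on `A` and `⟨e⟩` and
conjugation by `e` on `B`. -/
noncomputable def factorConj : MulAut (AdjoinFree G) :=
  MonoidHom.toMulEquiv (factorConjHom h e) (factorConjHom h e⁻¹)
    (factorConjHom_comp h (factorConjHom_e h _) (mul_inv_cancel e))
    (factorConjHom_comp h (by rw [map_inv, factorConjHom_e]) (inv_mul_cancel e))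

theorem factorConj_left (a : A) : factorConj h (ofBase (a : G)) = ofBase (a : G) :=
  factorConjHom_left h e a

theorem factorConj_right (b : B) :
    factorConj h (ofBase (b : G)) = e * ofBase (b : G) * e⁻¹ :=
  factorConjHom_right h e b

theorem conj_e_notMem_range {g : G} (hg : g ≠ 1) :
    e * ofBase g * e⁻¹ ∉ (ofBase : G →* AdjoinFree G).range := fun h =>
  e_notMem_range (mem_range_of_conj_mem_range hg h)

theorem conj_e_ne_one {g : G} (hg : g ≠ 1) : e * ofBase g * e⁻¹ ≠ (1 : AdjoinFree G) := fun h =>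
  conj_e_notMem_range hg (h ▸ one_mem _)

/-- Equal centralizers would make $ege^{-1}$ commute with $g'$. Malnormality of $G$ would put
$ege^{-1}$, and then $e$, in $G$. -/
theorem elemCentralizer_conj_e_ne {g g' : G} (hg : g ≠ 1)
    (hg' : (ofBase g' : AdjoinFree G) ≠ 1) :
    elemCentralizer (e * ofBase g * e⁻¹) ≠ elemCentralizer (ofBase g') := by
  intro h
  have h1 := mem_elemCentralizer_self (e * ofBase g * e⁻¹)
  rw [h, Subgroup.mem_centralizer_singleton_iff] at h1
  refine conj_e_notMem_range hg (mem_range_of_mul_eq_mul (w := g') (fun h0 => hg' ?_) h1)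
  rw [h0, map_one]

/-- Otherwise $a$ and $c$ commute, and `factorConj` makes $a$ commute with $ece^{-1}$, which
malnormality of the base forbids. -/
theorem isIndependent_of_mem_factors
    (h : Function.Bijective (Monoid.Coprod.lift A.subtype B.subtype))
    (hab : ∀ g x y : G, g ≠ 1 → Commute g x → Commute g y → Commute x y)
    {a c : G} (haA : a ∈ A) (hcB : c ∈ B) (ha : a ≠ 1) (hc : c ≠ 1) : IsIndependent a c := by
  refine ⟨ha, hc, fun g h1 h2 => ?_⟩
  by_contra hg
  have h3 := congrArg (fun x => factorConj h (ofBase x)) (hab g a c hg h1.symm h2.symm).eq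
  simp only [map_mul, factorConj_left h ⟨a, haA⟩, factorConj_right h ⟨c, hcB⟩] at h3
  exact conj_e_notMem_range hc (mem_range_of_mul_eq_mul ha h3.symm)

/-- The automorphism `factorConj` moves every alternating product without trivial factors to a
cyclically reduced word. -/
theorem exists_factorConj_pairsProd {l : List (B × A)} (hl : l ≠ [])
    (hl1 : ∀ p ∈ l, p.1 ≠ 1 ∧ p.2 ≠ 1) : ∃ w : List (ℤˣ × G), w ≠ [] ∧ IsCyclicallyReduced w ∧
      factorConj h (ofBase (Subgroup.pairsProd l)) = wordProd w := by
  refine ⟨l.flatMap fun p => [(1, (p.1 : G)), (-1, (p.2 : G))], ?_, ?_, ?_⟩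
  · cases l with
    | nil => exact absurd rfl hl
    | cons p l => simp
  -- All coefficients are nontrivial, so no two letters can cancel.
  · refine Cycle.chain_of_pairwise fun x hx y _ hx1 => absurd hx1 ?_
    rw [Cycle.mem_coe_iff, List.mem_flatMap] at hx
    obtain ⟨p, hp, hx⟩ := hx
    obtain ⟨h1, h2⟩ := hl1 p hp
    simp only [List.mem_cons, List.not_mem_nil, or_false] at hx
    rcases hx with rfl | rfl
    · simpa using h1
    · simpa using h2
  · clear hl hl1
    induction l with
    | nil => simp
    | cons p l ih => simp [ih, factorConj_left, factorConj_right, mul_assoc]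

theorem not_comesFrom_conj_e_home {g : G} (hg : g ≠ 1) :
    ¬ (MulAut.conj (e : AdjoinFree G) • WE.home (ofBase g)).ComesFrom ofBase := by
  change ¬ (WE.home (e * ofBase g * e⁻¹)).ComesFrom ofBase
  intro hβ
  generalize hx : WE.home (e * ofBase g * e⁻¹) = β at hβ
  cases hβ <;> simp only [reduceCtorEq, WE.home.injEq] at hx
  exact conj_e_notMem_range hg ⟨_, hx.symm⟩

theorem not_comesFrom_conj_e_leftCoset (m : ℕ) (a : G) {b : G} (hb : b ≠ 1) :
    ¬ (MulAut.conj (e : AdjoinFree G) •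
      WE.leftCoset m (Quot.mk _ (ofBase a, ofBase b))).ComesFrom ofBase := by
  change ¬ (WE.leftCoset m
    (Quot.mk _ (e * ofBase a * e⁻¹, e * ofBase b * e⁻¹))).ComesFrom ofBase
  intro hβ
  generalize hx : WE.leftCoset m (Quot.mk _ (e * ofBase a * e⁻¹, e * ofBase b * e⁻¹)) = β at hβ
  cases hβ <;> simp only [reduceCtorEq, WE.leftCoset.injEq] at hx
  obtain ⟨rfl, hx⟩ := hx
  rcases leftCosetRel_eq_or_of_mk_eq (eq_of_heq hx) with h1 | ⟨h1, -⟩ | ⟨-, h2, b', h3, h4, -⟩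
  · exact conj_e_notMem_range hb ⟨_, (Prod.mk.inj h1).2.symm⟩
  · exact conj_e_ne_one hb h1
  · exact elemCentralizer_conj_e_ne hb h2 (h3.trans h4.symm)

theorem not_comesFrom_conj_e_rightCoset (m : ℕ) (a : G) {b : G} (hb : b ≠ 1) :
    ¬ (MulAut.conj (e : AdjoinFree G) •
      WE.rightCoset m (Quot.mk _ (ofBase a, ofBase b))).ComesFrom ofBase := by
  change ¬ (WE.rightCoset m
    (Quot.mk _ (e * ofBase a * e⁻¹, e * ofBase b * e⁻¹))).ComesFrom ofBase
  intro hβ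
  generalize hx : WE.rightCoset m (Quot.mk _ (e * ofBase a * e⁻¹, e * ofBase b * e⁻¹)) = β at hβ
  cases hβ <;> simp only [reduceCtorEq, WE.rightCoset.injEq] at hx
  obtain ⟨rfl, hx⟩ := hx
  rcases rightCosetRel_eq_or_of_mk_eq (eq_of_heq hx) with h1 | ⟨h1, -⟩ | ⟨-, h2, b', h3, h4, -⟩
  · exact conj_e_notMem_range hb ⟨_, (Prod.mk.inj h1).2.symm⟩
  · exact conj_e_ne_one hb h1
  · exact elemCentralizer_conj_e_ne hb h2 (h3.trans h4.symm)

theorem not_comesFrom_conj_e_doubleCoset (m n : ℕ) {a : G} (b : G) {c : G} (ha : a ≠ 1)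
    (hc : c ≠ 1) : ¬ (MulAut.conj (e : AdjoinFree G) •
      WE.doubleCoset m n (Quot.mk _ (ofBase a, ofBase b, ofBase c))).ComesFrom ofBase := by
  change ¬ (WE.doubleCoset m n (Quot.mk _
    (e * ofBase a * e⁻¹, e * ofBase b * e⁻¹, e * ofBase c * e⁻¹))).ComesFrom ofBase
  intro hβ
  generalize hx : WE.doubleCoset m n (Quot.mk _
    (e * ofBase a * e⁻¹, e * ofBase b * e⁻¹, e * ofBase c * e⁻¹)) = β at hβ
  cases hβ <;> simp only [reduceCtorEq, WE.doubleCoset.injEq] at hx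
  obtain ⟨rfl, rfl, hx⟩ := hx
  rcases doubleCosetRel_eq_or_of_mk_eq (eq_of_heq hx) with
    h1 | ⟨h1 | h1, -⟩ | ⟨-, -, h2, -, a', c', h3, h4, -⟩
  · exact conj_e_notMem_range ha ⟨_, (Prod.mk.inj h1).1.symm⟩
  · exact conj_e_ne_one ha h1
  · exact conj_e_ne_one hc h1
  · exact elemCentralizer_conj_e_ne ha h2 (h3.trans h4.symm)

/-- A nontrivial element of `H^we` other than the conjugacy class of an element of a factor of the
base can be moved out of `G^we`. -/
theorem exists_not_comesFrom_smul
    (h : Function.Bijective (Monoid.Coprod.lift A.subtype B.subtype))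
    {β : WE (AdjoinFree G)} (hβ : ¬ β.IsTrivial)
    (hAB : ∀ x : G, x ∈ A ∨ x ∈ B → β ≠ WE.conj (ConjClasses.mk (ofBase x))) :
    ∃ f : MulAut (AdjoinFree G), ¬ (f • β).ComesFrom ofBase := by
  by_cases hG : β.ComesFrom ofBase
  swap
  · exact ⟨1, by rwa [one_smul]⟩
  cases hG with
  | home g =>
    refine ⟨MulAut.conj e, not_comesFrom_conj_e_home fun hg => hβ ?_⟩
    rw [hg, map_one]
    exact .home
  | conj g =>
    -- Inner automorphisms fix every conjugacy class, so only one factor is conjugated by $e$.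
    refine ⟨factorConj h, fun hg => ?_⟩
    obtain ⟨l, rfl⟩ := Subgroup.exists_pairsProd_eq h.surjective g
    rcases Subgroup.isConj_pairsProd l with ⟨x, hx, h1⟩ | ⟨l', h1, h2, h3⟩
    · exact hAB x hx (congrArg WE.conj
        (ConjClasses.mk_eq_mk_iff_isConj.2 (MonoidHom.map_isConj ofBase h1)))
    · obtain ⟨w, hw, hw', heq⟩ := exists_factorConj_pairsProd h h1 h2
      change (WE.conj (ConjClasses.mk
        (factorConj h (ofBase (Subgroup.pairsProd l))))).ComesFrom ofBase at hg
      generalize hx : WE.conj (ConjClasses.mk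
        (factorConj h (ofBase (Subgroup.pairsProd l)))) = γ at hg
      cases hg with
      | conj g =>
        have h4 := ConjClasses.mk_eq_mk_iff_isConj.1 (WE.conj.inj hx)
        have h5 : IsConj (factorConj h (ofBase (Subgroup.pairsProd l)))
            (factorConj h (ofBase (Subgroup.pairsProd l'))) :=
          MonoidHom.map_isConj ((factorConj h).toMonoidHom.comp ofBase) h3
        rw [heq] at h5
        exact not_isConj_ofBase hw' hw g (h5.symm.trans h4)
      | _ => simp only [reduceCtorEq] at hx
  | leftCoset m a b =>
    refine ⟨MulAut.conj e, not_comesFrom_conj_e_leftCoset m a fun hb => hβ ?_⟩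
    have : Quot.mk (LeftCosetRel (AdjoinFree G) m) (ofBase a, ofBase b) = Quot.mk _ (1, 1) :=
      Quot.sound (Or.inl ⟨by simp [hb], rfl⟩)
    rw [this]
    exact .leftCoset m
  | rightCoset m a b =>
    refine ⟨MulAut.conj e, not_comesFrom_conj_e_rightCoset m a fun hb => hβ ?_⟩
    have : Quot.mk (RightCosetRel (AdjoinFree G) m) (ofBase a, ofBase b) = Quot.mk _ (1, 1) :=
      Quot.sound (Or.inl ⟨by simp [hb], rfl⟩)
    rw [this]
    exact .rightCoset m
  | doubleCoset m n a b c =>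
    by_cases hac : a = 1 ∨ c = 1
    · refine absurd ?_ hβ
      have : Quot.mk (DoubleCosetRel (AdjoinFree G) m n) (ofBase a, ofBase b, ofBase c) =
          Quot.mk _ (1, 1, 1) :=
        Quot.sound (Or.inl ⟨hac.imp (by simp +contextual) (by simp +contextual), Or.inl rfl⟩)
      rw [this]
      exact .doubleCoset m n
    · rw [not_or] at hac
      exact ⟨MulAut.conj e, not_comesFrom_conj_e_doubleCoset m n b hac.1 hac.2⟩

end AdjoinFree

/-! ### The theorem -/

theorem mainTheorem8 {G : Type*} [Group G] (hG : IsHyperbolicGroup G)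
    (htf : IsTorsionFreeGroup G) :
    (∀ a c : G, a ≠ 1 → c ≠ 1 → elemCentralizer a ≠ elemCentralizer c →
      ∀ β : WE (AdjoinFree G), ¬ β.ComesFrom AdjoinFree.ofBase →
        (MulAction.orbit (Subgroup.closure {AdjoinFree.shift a, AdjoinFree.shift c}) β).Infinite) ∧
    (∀ A B : Subgroup G, IsNontrivialFreeProduct A B →
      (∀ β : WE (AdjoinFree G), ¬ β.ComesFrom AdjoinFree.ofBase →
        (MulAction.orbit (MulAut (AdjoinFree G)) β).Infinite) ∧
      (∀ β : WE (AdjoinFree G), ¬ β.IsTrivial →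
        (∀ x : G, x ∈ A ∨ x ∈ B → β ≠ WE.conj (ConjClasses.mk (AdjoinFree.ofBase x))) →
        (MulAction.orbit (MulAut (AdjoinFree G)) β).Infinite)) := by
  have hab : ∀ g x y : G, g ≠ 1 → Commute g x → Commute g y → Commute x y :=
    fun g x y hg hx hy => hG.commute_of_commute htf hg hx hy
  refine ⟨fun a c ha hc h β hβ => AdjoinFree.infinite_orbit_closure_shift htf hab
    (AdjoinFree.isIndependent_of_elemCentralizer_ne hab ha hc h) hβ, ?_⟩
  rintro A B ⟨hA, hB, hbij⟩
  obtain ⟨a, haA, ha⟩ := A.bot_or_exists_ne_one.resolve_left hA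
  obtain ⟨c, hcB, hc⟩ := B.bot_or_exists_ne_one.resolve_left hB
  have hac := AdjoinFree.isIndependent_of_mem_factors hbij hab haA hcB ha hc
  have key : ∀ β : WE (AdjoinFree G), ¬ β.ComesFrom AdjoinFree.ofBase →
      (MulAction.orbit (MulAut (AdjoinFree G)) β).Infinite := by
    intro β hβ
    refine (AdjoinFree.infinite_orbit_closure_shift htf hab hac hβ).mono ?_
    rintro _ ⟨f, rfl⟩
    exact MulAction.mem_orbit β (f : MulAut (AdjoinFree G))
  refine ⟨key, fun β hβ hAB => ?_⟩
  obtain ⟨f, hf⟩ := AdjoinFree.exists_not_comesFrom_smul hbij hβ hAB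
  rw [← MulAction.orbit_smul f β]
  exact key _ hf
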